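/- Call a finite group $G$ a Leinster group if the sum of the orders of all its normal subgroups (including the trivial subgroup and $G$ itself) equals $2|G|$. Write $C_m$ for the cyclic group of order $m$, and $Q_{4n}=\langle a,x \mid a^{2n}=1,\ x^2=a^n,\ x^{-1}ax=a^{-1}\rangle$ for the generalized quaternion (dicyclic) group of order $4n$. Let $p<q<r$ be primes and let $G$ be a group of order $p^2qr$. Then $G$ is a Leinster group if and only if $G\cong Q_{20}\times C_{19}$ or $G\cong Q_{28}\times C_{13}$. -/

import Mathlib

/-- The sum of the orders of the normal subgroups of a group `G`
(a finite sum whenever `G` is finite). -/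
noncomputable def normalSubgroupOrderSum (G : Type*) [Group G] : ℕ :=
  ∑ᶠ N : {N : Subgroup G // N.Normal}, Nat.card N.1

/-- A Leinster group: a finite group such that the sum of the orders of its normal subgroups
(including the trivial subgroup and the whole group) is twice the order of the group. -/
def IsLeinster (G : Type*) [Group G] : Prop :=
  Finite G ∧ normalSubgroupOrderSum G = 2 * Nat.card G

/-! Write δ(G) for the sum of the orders of the normal subgroups, and suppose δ(G) = 2|G|. The
proper nontrivial normal subgroups have orders adding up to |G| - 1, so they cannot cover G. Hence G
is the normal closure of one element, and every abelian quotient of G is cyclic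
(`exists_forall_normal_eq_top`).

Burnside transfer gives a normal subgroup K of order qr, because a group of order p² has no
automorphism of prime order ℓ > p unless p = 2 and ℓ = 3. In the exceptional case |G| = 12r, parity
of δ(G) yields a nontrivial normal subgroup of odd order, and then either K exists or δ(G) < 2|G|.

Now G/K has order p², so it is abelian, hence cyclic. This makes N ↦ |N| an injective lattice map
from the normal subgroups to the divisors of |G| (`HasDistributiveOrders`), and δ(G) is a sum of
distinct divisors. For p ≥ 3 even the sum of all divisors is below 2|G|. For p = 2, closure under
gcd and lcm leaves few patterns of orders, and the equation qr = rs + qt + u with s, t, u ≤ 7 bounds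
q. The survivors are (5, 19) and (7, 13), where every divisor except 4 and 4r is the order of a
normal subgroup, together with spurious solutions for q = 3, which a centralizer argument excludes.

That pattern forces G = H × C_r with |H| = 4q, and H is dicyclic. Conversely, in Q_{4q} × C_r the
same pattern gives δ = 7qr + 7q + 3r + 3, which equals 8qr for both pairs. -/

/-- `G` has a normal subgroup of order `d`. -/
def HasNormalOfCard (G : Type*) [Group G] (d : ℕ) : Prop :=
  ∃ N : Subgroup G, N.Normal ∧ Nat.card N = d

/-! ### Normal Hall subgroups and Sylow counting -/

section Hall

variable {G : Type*} [Group G] [Finite G]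

-- The image in `G ⧸ N` of an element of `H` has order dividing both `Nat.card H` and `N.index`.
omit [Finite G] in
theorem Subgroup.le_of_coprime_card_index {N : Subgroup G} [N.Normal] {H : Subgroup G}
    (h : (Nat.card H).Coprime N.index) : H ≤ N := by
  intro x hx
  have h1 : orderOf (x : G ⧸ N) = 1 := ?_
  · rwa [orderOf_eq_one_iff, QuotientGroup.eq_one_iff] at h1
  refine Nat.eq_one_of_dvd_coprimes h ?_ ?_
  · exact (orderOf_map_dvd (QuotientGroup.mk' N) x).trans (H.orderOf_dvd_natCard hx)
  · rw [Subgroup.index_eq_card]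
    exact _root_.orderOf_dvd_natCard _

theorem Subgroup.eq_of_card_eq_of_coprime_index {N : Subgroup G} [N.Normal] {H : Subgroup G}
    (hc : Nat.card H = Nat.card N) (h : (Nat.card N).Coprime N.index) : H = N :=
  Subgroup.eq_of_le_of_card_ge (Subgroup.le_of_coprime_card_index (hc ▸ h)) hc.ge

-- A normal Hall subgroup contains every subgroup of its own order, so it is characteristic.
omit [Finite G] in
theorem Subgroup.normal_map_subtype_of_coprime_index {M : Subgroup G} [M.Normal]
    {N : Subgroup M} [N.Normal] (h : (Nat.card N).Coprime N.index) :
    (N.map M.subtype).Normal := by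
  have : N.Characteristic := by
    rw [Subgroup.characteristic_iff_map_le]
    intro φ
    refine Subgroup.le_of_coprime_card_index ?_
    rwa [Subgroup.card_map_of_injective φ.injective]
  infer_instance

theorem HasNormalOfCard.of_subgroup {M : Subgroup G} [M.Normal] {m n : ℕ}
    (hM : HasNormalOfCard M m) (hc : Nat.card M = m * n) (hmn : m.Coprime n) :
    HasNormalOfCard G m := by
  obtain ⟨N, hN, rfl⟩ := hM
  have hi : N.index = n := by
    have := N.card_mul_index
    rw [hc] at this
    exact Nat.eq_of_mul_eq_mul_left Nat.card_pos this
  exact ⟨N.map M.subtype, Subgroup.normal_map_subtype_of_coprime_index (hi ▸ hmn),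
    Subgroup.card_map_of_injective M.subtype_injective⟩

theorem HasNormalOfCard.of_quotient {M : Subgroup G} [M.Normal] {m : ℕ}
    (h : HasNormalOfCard (G ⧸ M) m) : HasNormalOfCard G (Nat.card M * m) := by
  obtain ⟨N, hN, rfl⟩ := h
  refine ⟨N.comap (QuotientGroup.mk' M), inferInstance, ?_⟩
  have h1 := (N.comap (QuotientGroup.mk' M)).card_mul_index
  rw [N.index_comap_of_surjective (QuotientGroup.mk'_surjective M)] at h1
  have h2 := N.card_mul_index
  have h3 := M.card_mul_index
  rw [Subgroup.index_eq_card] at h3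
  have h4 : 0 < N.index := Nat.pos_of_ne_zero Subgroup.index_ne_zero_of_finite
  refine Nat.eq_of_mul_eq_mul_right h4 ?_
  rw [h1, ← h3, ← h2, mul_assoc]

omit [Finite G] in
theorem Subgroup.card_sup_mul_card_inf (N M : Subgroup G) [M.Normal] :
    Nat.card (N ⊔ M : Subgroup G) * Nat.card (N ⊓ M : Subgroup G) =
      Nat.card N * Nat.card M := by
  have h1 := Subgroup.relIndex_sup_right N M
  have h2 := Subgroup.relIndex_mul_relIndex ⊥ M (N ⊔ M) bot_le le_sup_right
  have h3 := Subgroup.relIndex_mul_relIndex ⊥ (M ⊓ N) N bot_le inf_le_right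
  simp only [Subgroup.relIndex_bot_left, Subgroup.inf_relIndex_right] at h2 h3
  rw [← h2, ← h3, h1, inf_comm]
  ring

/-- A Sylow subgroup is normal if no nontrivial number of Sylow subgroups is possible. -/
theorem hasNormalOfCard_prime_pow {p k m : ℕ} (hp : p.Prime) (hc : Nat.card G = p ^ k * m)
    (hpm : ¬ p ∣ m) (h : ∀ d, d ∣ m → d ≡ 1 [MOD p] → d = 1) :
    HasNormalOfCard G (p ^ k) := by
  have := Fact.mk hp
  have P : Sylow p G := default
  have hk : Nat.card P = p ^ k := by
    rw [P.card_eq_multiplicity, hc, Nat.factorization_mul (pow_ne_zero _ hp.ne_zero)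
      (by rintro rfl; simp at hpm)]
    simp [hp.factorization, Nat.factorization_eq_zero_of_not_dvd hpm]
  refine ⟨P, ?_, hk⟩
  have hi : (P : Subgroup G).index = m := by
    have := (P : Subgroup G).card_mul_index
    rw [hk, hc] at this
    exact Nat.eq_of_mul_eq_mul_left (pow_pos hp.pos _) this
  have h1 : Nat.card (Sylow p G) = 1 :=
    h _ (hi ▸ P.card_dvd_index) (card_sylow_modEq_one p G)
  have : Subsingleton (Sylow p G) := (Nat.card_eq_one_iff_unique.mp h1).1
  exact P.normal_of_subsingleton

end Hall

/-! ### The sum of the orders of the normal subgroups -/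

section Sum

variable {G : Type*} [Group G] [Finite G]

/-- The trivial subgroup contributes the only odd term. -/
theorem odd_normalSubgroupOrderSum
    (h : ∀ N : Subgroup G, N.Normal → Odd (Nat.card N) → N = ⊥) :
    Odd (normalSubgroupOrderSum G) := by
  classical
  have := Fintype.ofFinite {N : Subgroup G // N.Normal}
  rw [normalSubgroupOrderSum, finsum_eq_sum_of_fintype,
    ← Finset.add_sum_erase _ _ (Finset.mem_univ ⟨⊥, inferInstance⟩)]
  simp only [Subgroup.card_bot]
  refine odd_one.add_even (Finset.even_sum _ ?_)
  rintro ⟨N, hN⟩ hm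
  rw [← Nat.not_odd_iff_even]
  intro ho
  simp [h N hN ho] at hm

open Classical in
theorem normalSubgroupOrderSum_eq_sum_divisors
    (h : ∀ N M : Subgroup G, N.Normal → M.Normal → Nat.card N = Nat.card M → N = M) :
    normalSubgroupOrderSum G =
      ∑ d ∈ (Nat.card G).divisors, if HasNormalOfCard G d then d else 0 := by
  have := Fintype.ofFinite {N : Subgroup G // N.Normal}
  rw [normalSubgroupOrderSum, finsum_eq_sum_of_fintype, ← Finset.sum_filter]
  refine Finset.sum_bij (fun N _ => Nat.card N.1) ?_ ?_ ?_ ?_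
  · rintro ⟨N, hN⟩ -
    simp only [Finset.mem_filter, Nat.mem_divisors]
    exact ⟨⟨N.card_subgroup_dvd_card, Nat.card_pos.ne'⟩, N, hN, rfl⟩
  · rintro ⟨N, hN⟩ - ⟨M, hM⟩ - hNM
    exact Subtype.ext (h N M hN hM hNM)
  · intro d hd
    obtain ⟨N, hN, rfl⟩ := (Finset.mem_filter.mp hd).2
    exact ⟨⟨N, hN⟩, Finset.mem_univ _, rfl⟩
  · simp

/-- A finite group with `δ(G) ≤ 2|G|` is the normal closure of one of its elements: otherwise it
is covered by its proper nontrivial normal subgroups. -/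
theorem exists_forall_normal_eq_top (hL : normalSubgroupOrderSum G ≤ 2 * Nat.card G) :
    ∃ g : G, ∀ N : Subgroup G, N.Normal → g ∈ N → N = ⊤ := by
  classical
  rcases subsingleton_or_nontrivial G with hs | hn
  · exact ⟨1, fun N _ _ => Subsingleton.elim _ _⟩
  by_contra! hcon
  choose F hF1 hF2 hF3 using hcon
  obtain ⟨g₀, hg₀⟩ := exists_ne (1 : G)
  have := Fintype.ofFinite {N : Subgroup G // N.Normal}
  have := Fintype.ofFinite G
  rw [normalSubgroupOrderSum, finsum_eq_sum_of_fintype,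
    ← Finset.add_sum_erase _ _ (Finset.mem_univ ⟨⊥, inferInstance⟩),
    ← Finset.add_sum_erase _ (a := ⟨⊤, inferInstance⟩) _ (by simp [top_ne_bot])] at hL
  set S := ((Finset.univ : Finset {N : Subgroup G // N.Normal}).erase
    ⟨⊥, inferInstance⟩).erase ⟨⊤, inferInstance⟩ with hS
  have hmem : ∀ g, g ≠ 1 → (⟨F g, hF1 g⟩ : {N : Subgroup G // N.Normal}) ∈ S := by
    intro g hg
    simp only [hS, Finset.mem_erase, ne_eq, Subtype.mk.injEq, Finset.mem_univ, and_true]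
    refine ⟨hF3 g, fun hb => hg ?_⟩
    have := hF2 g
    rwa [hb, Subgroup.mem_bot] at this
  have hcover : (Finset.univ : Finset G) ⊆ S.biUnion fun N => (N.1 : Set G).toFinset := by
    intro g _
    simp only [Finset.mem_biUnion, Set.mem_toFinset]
    by_cases hg : g = 1
    · exact ⟨_, hmem g₀ hg₀, hg ▸ one_mem (F g₀)⟩
    · exact ⟨_, hmem g hg, hF2 g⟩
  -- The cover gives |G| ≤ ∑ over `S`, whereas removing 1 and |G| from `hL` leaves at most |G| - 1.
  have h1 := (Finset.card_le_card hcover).trans Finset.card_biUnion_le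
  rw [Finset.card_univ, ← Nat.card_eq_fintype_card] at h1
  have h2 : ∑ N ∈ S, (N.1 : Set G).toFinset.card = ∑ N ∈ S, Nat.card N.1 := by
    refine Finset.sum_congr rfl fun N _ => ?_
    rw [Set.toFinset_card, Nat.card_eq_fintype_card]
    rfl
  rw [h2] at h1
  simp only [Subgroup.card_bot, Subgroup.card_top] at hL
  omega

-- The preimage of the subgroup generated by the image of `g` is normal since the quotient is
-- commutative, and it contains `g`.
omit [Finite G] in
theorem mem_zpowers_of_forall_normal_eq_top {g : G}
    (hg : ∀ N : Subgroup G, N.Normal → g ∈ N → N = ⊤) (K : Subgroup G) [K.Normal]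
    [IsMulCommutative (G ⧸ K)] (x : G ⧸ K) : x ∈ Subgroup.zpowers (g : G ⧸ K) := by
  have h := hg ((Subgroup.zpowers (g : G ⧸ K)).comap (QuotientGroup.mk' K)) inferInstance
    (by simp)
  obtain ⟨y, rfl⟩ := QuotientGroup.mk'_surjective K x
  have : y ∈ (⊤ : Subgroup G) := Subgroup.mem_top _
  rw [← h] at this
  exact this

omit [Finite G] in
theorem normalSubgroupOrderSum_congr {H : Type*} [Group H] (e : G ≃* H) :
    normalSubgroupOrderSum G = normalSubgroupOrderSum H := by
  unfold normalSubgroupOrderSum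
  refine finsum_eq_of_bijective
    (fun N => ⟨N.1.map e.toMonoidHom, N.2.map _ e.surjective⟩) ⟨?_, ?_⟩ ?_
  · rintro ⟨N, hN⟩ ⟨M, hM⟩ h
    exact Subtype.ext (Subgroup.map_injective e.injective (Subtype.mk.inj h))
  · rintro ⟨N, hN⟩
    refine ⟨⟨N.comap e.toMonoidHom, inferInstance⟩, Subtype.ext ?_⟩
    exact Subgroup.map_comap_eq_self_of_surjective e.surjective N
  · rintro ⟨N, hN⟩
    exact (Subgroup.card_map_of_injective e.injective).symm

end Sum

/-! ### Normal complements by Burnside transfer -/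

/-- An automorphism of prime order `ℓ > p` of a group of order `p ^ 2` only exists for
`p = 2`, `ℓ = 3`. -/
theorem MulAut.orderOf_ne_of_card_eq_prime_sq {P : Type*} [Group P] {p ℓ : ℕ} (hp : p.Prime)
    (hℓ : ℓ.Prime) (hlt : p < ℓ) (hc : Nat.card P = p ^ 2) (hne : ¬ (p = 2 ∧ ℓ = 3))
    (α : MulAut P) : orderOf α ≠ ℓ := by
  intro hα
  have := Fact.mk hℓ
  have hfin : Finite P := Nat.finite_of_card_ne_zero (by rw [hc]; exact pow_ne_zero _ hp.ne_zero)
  have hpg : IsPGroup ℓ (Subgroup.zpowers α) :=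
    IsPGroup.of_card (n := 1) (by rw [Nat.card_zpowers, hα, pow_one])
  have hmod := hpg.card_modEq_card_fixedPoints P
  let F : Subgroup P := MonoidHom.eqLocus α.toMonoidHom (MonoidHom.id P)
  have hF : (F : Set P) = MulAction.fixedPoints (Subgroup.zpowers α) P := by
    ext x
    constructor
    · rintro (hx : α x = x) ⟨β, hβ⟩
      have : α ∈ MulAction.stabilizer (MulAut P) x := hx
      exact (Subgroup.zpowers_le.mpr this) hβ
    · intro hx
      exact hx ⟨α, Subgroup.mem_zpowers α⟩
  have hFc : Nat.card (MulAction.fixedPoints (Subgroup.zpowers α) P) = Nat.card F := by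
    rw [← hF]; rfl
  rw [hFc, hc] at hmod
  have hdvd : Nat.card F ∣ p ^ 2 := hc ▸ F.card_subgroup_dvd_card
  have hp2 := hp.two_le
  obtain ⟨k, hk, hkF⟩ := (Nat.dvd_prime_pow hp).mp hdvd
  rw [hkF] at hmod
  have hmod' := ((Nat.modEq_iff_dvd' (Nat.pow_le_pow_right hp.pos hk)).mp hmod.symm)
  -- The fixed points form a subgroup of order p^k congruent to p² mod ℓ. For k = 0, ℓ divides (p +
  -- 1)(p - 1), so ℓ = p + 1 and the primes are 2 and 3. For k = 1, ℓ would divide p(p - 1). For k =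
  -- 2, α is trivial.
  interval_cases k
  · have h1 : p ^ 2 - p ^ 0 = (p + 1) * (p - 1) := by
      simpa using Nat.sq_sub_sq p 1
    rw [h1, hℓ.dvd_mul] at hmod'
    rcases hmod' with h | h
    · have h2 : ℓ = p + 1 := le_antisymm (Nat.le_of_dvd (by omega) h) hlt
      rcases hp.eq_two_or_odd' with h3 | h3
      · exact hne ⟨h3, by omega⟩
      · have : Even ℓ := h2 ▸ h3.add_one
        have := (hℓ.even_iff).mp this
        omega
    · have := Nat.le_of_dvd (by omega) h
      omega
  · have h1 : p ^ 2 - p ^ 1 = p * (p - 1) := by rw [Nat.mul_sub]; ring_nf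
    rw [h1, hℓ.dvd_mul] at hmod'
    rcases hmod' with h | h <;>
    · have := Nat.le_of_dvd (by omega) h
      omega
  · have hFt : F = ⊤ := Subgroup.eq_top_of_card_eq F (by rw [hkF, hc])
    have : α = 1 := by
      ext x
      have : x ∈ F := hFt ▸ Subgroup.mem_top x
      exact this
    rw [this, orderOf_one] at hα
    exact hℓ.one_lt.ne hα

/-- If `p` is the least prime divisor of `p ^ 2 * m`, `p` does not divide `m`, and `(p, m)` is not
of the form `(2, 3 * k)`, then a group of order `p ^ 2 * m` has a normal `p`-complement. -/
theorem hasNormalOfCard_of_card_eq_prime_sq_mul {G : Type*} [Group G] {p m : ℕ} (hp : p.Prime)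
    (hc : Nat.card G = p ^ 2 * m) (hm : ∀ ℓ, ℓ.Prime → ℓ ∣ m → p < ℓ)
    (hne : p = 2 → ¬ 3 ∣ m) : HasNormalOfCard G m := by
  have := Fact.mk hp
  have hm0 : m ≠ 0 := by
    rintro rfl
    exact (hm p hp (dvd_zero p)).false
  have hpm : ¬ p ∣ m := fun h => (hm p hp h).false
  have hfin : Finite G := Nat.finite_of_card_ne_zero (by
    rw [hc]; exact mul_ne_zero (pow_ne_zero _ hp.ne_zero) hm0)
  have P : Sylow p G := default
  have hk : Nat.card P = p ^ 2 := by
    rw [P.card_eq_multiplicity, hc, Nat.factorization_mul (pow_ne_zero _ hp.ne_zero) hm0]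
    simp [hp.factorization, Nat.factorization_eq_zero_of_not_dvd hpm]
  have hi : (P : Subgroup G).index = m := by
    have := (P : Subgroup G).card_mul_index
    rw [hk, hc] at this
    exact Nat.eq_of_mul_eq_mul_left (pow_pos hp.pos _) this
  have hcomm : IsMulCommutative P := IsPGroup.isMulCommutative_of_card_eq_prime_sq hk
  -- Burnside's hypothesis: N(P)/C(P) embeds in Aut P, and its order divides m because P is abelian.
  -- A prime divisor would give a forbidden automorphism.
  have hle : Subgroup.normalizer (P : Set G) ≤ Subgroup.centralizer (P : Set G) := by
    rw [← Subgroup.relIndex_eq_one]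
    by_contra hne1
    obtain ⟨ℓ, hℓ, hdvd⟩ := Nat.exists_prime_and_dvd hne1
    have hℓm : ℓ ∣ m := by
      refine hdvd.trans ?_
      rw [← hi]
      exact (Subgroup.relIndex_dvd_of_le_left _ (P : Subgroup G).le_centralizer).trans
        (Subgroup.relIndex_dvd_index_of_le (P : Subgroup G).le_normalizer)
    have := Fact.mk hℓ
    have hr : Nat.card (P : Subgroup G).normalizerMonoidHom.range =
        (Subgroup.centralizer (P : Set G)).relIndex (Subgroup.normalizer (P : Set G)) := by
      rw [← Subgroup.index_ker, Subgroup.normalizerMonoidHom_ker]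
      rfl
    rw [← hr] at hdvd
    obtain ⟨α, hα⟩ := exists_prime_orderOf_dvd_card' ℓ hdvd
    refine MulAut.orderOf_ne_of_card_eq_prime_sq hp hℓ (hm ℓ hℓ hℓm) hk ?_ α.1
      ((Subgroup.orderOf_coe α).trans hα)
    rintro ⟨h2, rfl⟩
    exact hne h2 hℓm
  have h := MonoidHom.ker_transferSylow_isComplement' P hle
  refine ⟨(MonoidHom.transferSylow P hle).ker, inferInstance, ?_⟩
  rw [← h.index_eq_card, hi]

/-- A group of order `2 * m` with `m` odd has a normal subgroup of order `m`. -/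
theorem hasNormalOfCard_of_card_eq_two_mul {G : Type*} [Group G] {m : ℕ}
    (hc : Nat.card G = 2 * m) (hm : Odd m) : HasNormalOfCard G m := by
  have hm0 := hm.pos
  have hfin : Finite G := Nat.finite_of_card_ne_zero (by omega)
  have hmin : (Nat.card G).minFac = 2 := by
    rw [Nat.minFac_eq_two_iff, hc]; exact dvd_mul_right _ _
  have P : Sylow 2 G := default
  have hpm : ¬ 2 ∣ m := by rw [← even_iff_two_dvd]; simpa using hm
  have hk : Nat.card P = 2 := by
    rw [P.card_eq_multiplicity, hc, Nat.factorization_mul two_ne_zero hm0.ne']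
    simp [Nat.prime_two.factorization, Nat.factorization_eq_zero_of_not_dvd hpm]
  have hcyc : IsCyclic P := isCyclic_of_prime_card hk
  have h := hcyc.isComplement' hmin
  refine ⟨(MonoidHom.transferSylow P (hcyc.normalizer_le_centralizer hmin)).ker,
    inferInstance, ?_⟩
  have h1 := h.card_mul_card
  have hk' : Nat.card (P : Subgroup G) = 2 := hk
  rw [hk', hc] at h1
  omega

/-- If a Sylow subgroup of prime order is central, it has a normal complement. -/
theorem hasNormalOfCard_of_le_center {G : Type*} [Group G] {ℓ m : ℕ} (hℓ : ℓ.Prime)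
    (hc : Nat.card G = ℓ * m) (hm : ¬ ℓ ∣ m) {Q : Subgroup G} (hQ : Nat.card Q = ℓ)
    (hcen : Q ≤ Subgroup.center G) : HasNormalOfCard G m := by
  have := Fact.mk hℓ
  have hm0 : m ≠ 0 := by rintro rfl; simp at hm
  have hfin : Finite G := Nat.finite_of_card_ne_zero (by
    rw [hc]; exact mul_ne_zero hℓ.ne_zero hm0)
  let P : Sylow ℓ G := Sylow.ofCard Q (by
    rw [hQ, hc, Nat.factorization_mul hℓ.ne_zero hm0]
    simp [hℓ.factorization, Nat.factorization_eq_zero_of_not_dvd hm])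
  have hPQ : Nat.card (P : Subgroup G) = ℓ := hQ
  have hle : Subgroup.normalizer (P : Set G) ≤ Subgroup.centralizer (P : Set G) := by
    have : Subgroup.centralizer (P : Set G) = ⊤ :=
      Subgroup.centralizer_eq_top_iff_subset.mpr hcen
    rw [this]
    exact le_top
  have h := MonoidHom.ker_transferSylow_isComplement' P hle
  refine ⟨(MonoidHom.transferSylow P hle).ker, inferInstance, ?_⟩
  have h1 := h.card_mul_card
  rw [hPQ, hc, mul_comm] at h1
  exact Nat.eq_of_mul_eq_mul_left hℓ.pos h1

/-! ### Orders of joins and meets of normal subgroups -/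

section Lattice

variable {G : Type*} [Group G] {p m : ℕ}

/-- `L` is the preimage of the unique subgroup of order p of the cyclic quotient of order p². If p²
does not divide |N|, the image of `N` has order dividing p and lies in that subgroup. -/
theorem exists_normal_forall_le [Finite G] (hp : p.Prime) (hc : Nat.card G = p ^ 2 * m)
    {K : Subgroup G} [K.Normal] (hK : Nat.card K = m) [IsCyclic (G ⧸ K)] :
    ∃ L : Subgroup G, L.Normal ∧ Nat.card L = p * m ∧
      ∀ N : Subgroup G, ¬ p ^ 2 ∣ Nat.card N → N ≤ L := by
  obtain ⟨g, hg⟩ := IsCyclic.exists_generator (α := G ⧸ K)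
  have hQ : Nat.card (G ⧸ K) = p ^ 2 := by
    have h1 := K.card_mul_index
    rw [Subgroup.index_eq_card, hK, hc, mul_comm] at h1
    exact Nat.eq_of_mul_eq_mul_right (hK ▸ Nat.card_pos) h1
  have hgo : orderOf g = p ^ 2 := (orderOf_eq_card_of_forall_mem_zpowers hg).trans hQ
  have hcomm : IsMulCommutative (G ⧸ K) := inferInstance
  have hA : Nat.card (Subgroup.zpowers (g ^ p)) = p := by
    rw [Nat.card_zpowers, orderOf_pow, hgo, sq, Nat.gcd_mul_left_left,
      Nat.mul_div_cancel _ hp.pos]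
  let L := (Subgroup.zpowers (g ^ p)).comap (QuotientGroup.mk' K)
  refine ⟨L, inferInstance, ?_, ?_⟩
  · have h1 := L.card_mul_index
    rw [Subgroup.index_comap_of_surjective _ (QuotientGroup.mk'_surjective K)] at h1
    have h2 := (Subgroup.zpowers (g ^ p)).card_mul_index
    have h3 : 0 < (Subgroup.zpowers (g ^ p)).index :=
      Nat.pos_of_ne_zero Subgroup.index_ne_zero_of_finite
    refine Nat.eq_of_mul_eq_mul_right h3 ?_
    rw [h1, hc, ← hQ, ← h2, hA]
    ring
  · intro N hN
    rw [← Subgroup.map_le_iff_le_comap]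
    have hd1 : Nat.card (N.map (QuotientGroup.mk' K)) ∣ p ^ 2 :=
      hQ ▸ Subgroup.card_subgroup_dvd_card _
    have hd2 : Nat.card (N.map (QuotientGroup.mk' K)) ∣ Nat.card N :=
      Subgroup.card_map_dvd N _
    have hdp : Nat.card (N.map (QuotientGroup.mk' K)) ∣ p := by
      obtain ⟨k, hk, hk'⟩ := (Nat.dvd_prime_pow hp).mp hd1
      rw [hk'] at hd2 ⊢
      interval_cases k
      · simp
      · simp
      · exact absurd hd2 hN
    intro x hx
    obtain ⟨k, rfl⟩ := hg x
    have h1 : (g ^ k) ^ p = 1 := by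
      rw [← orderOf_dvd_iff_pow_eq_one]
      exact (Subgroup.orderOf_dvd_natCard _ hx).trans hdp
    rw [← zpow_natCast, ← zpow_mul, ← orderOf_dvd_iff_zpow_eq_one, hgo] at h1
    push_cast at h1
    rw [sq] at h1
    obtain ⟨j, rfl⟩ := Int.dvd_of_mul_dvd_mul_right (by exact_mod_cast hp.ne_zero) h1
    exact ⟨j, by simp [zpow_mul]⟩

/-- Prime powers are compared. A first power is inherited from |N||M|. The only square to check is
p², and it cannot appear in the join alone: if it divides neither order, both subgroups lie in `L`,
and so does their join. -/
theorem Subgroup.card_sup_dvd_lcm (hsq : ∀ ℓ k, ℓ.Prime → 2 ≤ k → ℓ ^ k ∣ Nat.card G →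
      ℓ = p ∧ k = 2) {L : Subgroup G} (hLc : ¬ p ^ 2 ∣ Nat.card L)
    (hL : ∀ N : Subgroup G, ¬ p ^ 2 ∣ Nat.card N → N ≤ L) (N M : Subgroup G) [M.Normal] :
    Nat.card (N ⊔ M : Subgroup G) ∣ Nat.lcm (Nat.card N) (Nat.card M) := by
  rw [Nat.dvd_iff_prime_pow_dvd_dvd]
  intro ℓ k hℓ hd
  rcases k with _ | _ | k
  · simp
  · simp only [zero_add, pow_one] at hd ⊢
    have h1 : ℓ ∣ Nat.card N * Nat.card M :=
      Subgroup.card_sup_mul_card_inf N M ▸ hd.mul_right _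
    exact (hℓ.dvd_mul.mp h1).elim (fun h => h.trans (Nat.dvd_lcm_left _ _))
      fun h => h.trans (Nat.dvd_lcm_right _ _)
  · obtain ⟨rfl, hk⟩ := hsq ℓ _ hℓ (by omega) (hd.trans (Subgroup.card_subgroup_dvd_card _))
    rw [hk] at hd ⊢
    by_cases h1 : ℓ ^ 2 ∣ Nat.card N
    · exact h1.trans (Nat.dvd_lcm_left _ _)
    by_cases h2 : ℓ ^ 2 ∣ Nat.card M
    · exact h2.trans (Nat.dvd_lcm_right _ _)
    exact absurd (hd.trans (Subgroup.card_dvd_of_le (sup_le (hL N h1) (hL M h2)))) hLc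

theorem Subgroup.card_inf_eq_gcd [Finite G] (h : ∀ N M : Subgroup G, N.Normal → M.Normal →
      Nat.card (N ⊔ M : Subgroup G) ∣ Nat.lcm (Nat.card N) (Nat.card M))
    (N M : Subgroup G) [N.Normal] [M.Normal] :
    Nat.card (N ⊓ M : Subgroup G) = Nat.gcd (Nat.card N) (Nat.card M) := by
  have h1 : Nat.card (N ⊔ M : Subgroup G) = Nat.lcm (Nat.card N) (Nat.card M) :=
    Nat.dvd_antisymm (h N M inferInstance inferInstance)
      (Nat.lcm_dvd (Subgroup.card_dvd_of_le le_sup_left) (Subgroup.card_dvd_of_le le_sup_right))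
  have h2 := Subgroup.card_sup_mul_card_inf N M
  rw [← Nat.gcd_mul_lcm (Nat.card N), mul_comm, ← h1] at h2
  exact Nat.eq_of_mul_eq_mul_right Nat.card_pos h2

end Lattice

/-- The normal subgroups of `G` are determined by their orders, and the set of these orders is
closed under `gcd` and `lcm`. -/
structure HasDistributiveOrders (G : Type*) [Group G] : Prop where
  card_injective : ∀ N M : Subgroup G, N.Normal → M.Normal → Nat.card N = Nat.card M → N = M
  gcd : ∀ a b, HasNormalOfCard G a → HasNormalOfCard G b → HasNormalOfCard G (Nat.gcd a b)
  lcm : ∀ a b, HasNormalOfCard G a → HasNormalOfCard G b → HasNormalOfCard G (Nat.lcm a b)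

theorem hasDistributiveOrders_of_card_sup_dvd_lcm {G : Type*} [Group G] [Finite G]
    (h : ∀ N M : Subgroup G, N.Normal → M.Normal →
      Nat.card (N ⊔ M : Subgroup G) ∣ Nat.lcm (Nat.card N) (Nat.card M)) :
    HasDistributiveOrders G where
  card_injective N M hN hM hc := by
    have h1 := Subgroup.card_inf_eq_gcd h N M
    rw [hc, Nat.gcd_self] at h1
    have h2 : N ⊓ M = M := Subgroup.eq_of_le_of_card_ge inf_le_right h1.ge
    have h3 : N ⊓ M = N := Subgroup.eq_of_le_of_card_ge inf_le_left (h1.trans hc.symm).ge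
    exact h3.symm.trans h2
  gcd := by
    rintro _ _ ⟨N, hN, rfl⟩ ⟨M, hM, rfl⟩
    exact ⟨N ⊓ M, inferInstance, Subgroup.card_inf_eq_gcd h N M⟩
  lcm := by
    rintro _ _ ⟨N, hN, rfl⟩ ⟨M, hM, rfl⟩
    refine ⟨N ⊔ M, inferInstance, Nat.dvd_antisymm (h N M hN hM) ?_⟩
    exact Nat.lcm_dvd (Subgroup.card_dvd_of_le le_sup_left) (Subgroup.card_dvd_of_le le_sup_right)

/-! ### Groups of order p²qr with cyclic quotient of order p² -/

section PrimeSqMul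

variable {p q r : ℕ}

theorem eq_of_prime_pow_dvd_sq_mul_mul (hp : p.Prime) (hq : q.Prime) (hr : r.Prime)
    (hpq : p < q) (hqr : q < r) (ℓ k : ℕ) (hℓ : ℓ.Prime) (hk : 2 ≤ k)
    (hd : ℓ ^ k ∣ p ^ 2 * (q * r)) : ℓ = p ∧ k = 2 := by
  have hn : p ^ 2 * (q * r) ≠ 0 :=
    mul_ne_zero (pow_ne_zero _ hp.ne_zero) (mul_ne_zero hq.ne_zero hr.ne_zero)
  rw [hℓ.pow_dvd_iff_le_factorization hn,
    Nat.factorization_mul (pow_ne_zero _ hp.ne_zero) (mul_ne_zero hq.ne_zero hr.ne_zero),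
    Nat.factorization_mul hq.ne_zero hr.ne_zero, Nat.factorization_pow, hp.factorization,
    hq.factorization, hr.factorization] at hd
  simp only [Finsupp.add_apply, Finsupp.smul_apply, Finsupp.single_apply, smul_eq_mul] at hd
  split_ifs at hd <;> omega

variable {G : Type*} [Group G]

/-- The orders of the normal subgroups when there is a normal subgroup of order `q * r` with
cyclic quotient. -/
theorem hasDistributiveOrders_of_isCyclic (hp : p.Prime) (hq : q.Prime) (hr : r.Prime)
    (hpq : p < q) (hqr : q < r) (hc : Nat.card G = p ^ 2 * (q * r))
    {K : Subgroup G} [K.Normal] (hK : Nat.card K = q * r) [IsCyclic (G ⧸ K)] :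
    HasDistributiveOrders G ∧ HasNormalOfCard G (p * (q * r)) := by
  have hfin : Finite G := Nat.finite_of_card_ne_zero (by
    rw [hc]
    exact mul_ne_zero (pow_ne_zero _ hp.ne_zero) (mul_ne_zero hq.ne_zero hr.ne_zero))
  obtain ⟨L, hLn, hLc, hL⟩ := exists_normal_forall_le hp hc hK
  refine ⟨hasDistributiveOrders_of_card_sup_dvd_lcm fun N M hN hM => ?_, L, hLn, hLc⟩
  refine Subgroup.card_sup_dvd_lcm (p := p) (L := L) ?_ ?_ hL N M
  · rw [hc]
    exact eq_of_prime_pow_dvd_sq_mul_mul hp hq hr hpq hqr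
  · rw [hLc, sq]
    intro h
    have h1 := Nat.dvd_of_mul_dvd_mul_left hp.pos h
    rw [hp.dvd_mul, Nat.prime_dvd_prime_iff_eq hp hq, Nat.prime_dvd_prime_iff_eq hp hr] at h1
    omega

/-- A normal subgroup of order `q * r`, `q < r` primes, contains a normal subgroup of
order `r`. -/
theorem hasNormalOfCard_of_mul (hq : q.Prime) (hr : r.Prime) (hqr : q < r) [Finite G]
    (h : HasNormalOfCard G (q * r)) : HasNormalOfCard G r := by
  obtain ⟨K, hK, hKc⟩ := h
  have hqr' : r.Coprime q := (Nat.coprime_primes hr hq).mpr hqr.ne'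
  refine HasNormalOfCard.of_subgroup (M := K) (n := q) ?_ (hKc.trans (mul_comm q r)) hqr'
  rw [← pow_one r]
  refine hasNormalOfCard_prime_pow (m := q) hr (by rw [hKc, pow_one, mul_comm]) ?_ ?_
  · exact hr.coprime_iff_not_dvd.mp hqr'
  · intro d hd hmod
    rcases (Nat.dvd_prime hq).mp hd with rfl | rfl
    · rfl
    · rw [Nat.ModEq, Nat.mod_eq_of_lt hqr, Nat.mod_eq_of_lt hr.one_lt] at hmod
      exact hmod

end PrimeSqMul

/-! ### Divisor sums and the Diophantine equation -/

section Arithmetic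

variable {p q r : ℕ}

theorem sum_divisors_mul_of_coprime {m n : ℕ} (h : m.Coprime n) (f : ℕ → ℕ) :
    ∑ d ∈ (m * n).divisors, f d = ∑ a ∈ m.divisors, ∑ b ∈ n.divisors, f (a * b) := by
  rw [Nat.divisors_mul, Finset.mul_def, Finset.sum_image, Finset.sum_product]
  rintro ⟨a, b⟩ hx ⟨c, d⟩ hy he
  exact h.mul_injOn_divisors hx hy he

theorem sum_divisors_prime_sq_mul_mul (hp : p.Prime) (hq : q.Prime) (hr : r.Prime)
    (hpq : p < q) (hqr : q < r) (f : ℕ → ℕ) :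
    ∑ d ∈ (p ^ 2 * (q * r)).divisors, f d =
      f 1 + f r + (f q + f (q * r)) + (f p + f (p * r) + (f (p * q) + f (p * (q * r)))) +
      (f (p ^ 2) + f (p ^ 2 * r) + (f (p ^ 2 * q) + f (p ^ 2 * (q * r)))) := by
  have h1 : q.Coprime r := (Nat.coprime_primes hq hr).mpr hqr.ne
  have h2 : p.Coprime q := (Nat.coprime_primes hp hq).mpr hpq.ne
  have h3 : p.Coprime r := (Nat.coprime_primes hp hr).mpr (hpq.trans hqr).ne
  rw [sum_divisors_mul_of_coprime ((h2.mul_right h3).pow_left 2), Nat.divisors_prime_pow hp]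
  simp only [sum_divisors_mul_of_coprime h1, hq.sum_divisors, hr.sum_divisors,
    Finset.sum_map, Finset.sum_range_succ, Finset.sum_range_zero, Function.Embedding.coeFn_mk]
  simp only [pow_zero, pow_one, one_mul, mul_one, zero_add]
  ring

theorem sigma_lt_two_mul (hp : 3 ≤ p) (hq : 5 ≤ q) (hr : 7 ≤ r) :
    (1 + p + p ^ 2) * ((1 + q) * (1 + r)) < 2 * (p ^ 2 * (q * r)) := by
  -- σ(n)/n is at most 13/9 · 6/5 · 8/7 = 624/315 < 2, the value at p = 3, q = 5, r = 7.
  have h1 : 9 * (1 + p + p ^ 2) ≤ 13 * p ^ 2 := by nlinarith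
  have h2 : 5 * (1 + q) ≤ 6 * q := by omega
  have h3 : 7 * (1 + r) ≤ 8 * r := by omega
  have h4 := Nat.mul_le_mul h1 (Nat.mul_le_mul h2 h3)
  have h5 : 0 < p ^ 2 * (q * r) := by positivity
  nlinarith

/-- The Diophantine equation governing the even case. -/
theorem eq_of_mul_eq_add {s t u : ℕ} (hq : q.Prime) (hr : r.Prime) (hq2 : 2 < q) (hqr : q < r)
    (h : q * r = r * s + q * t + u)
    (hs : s = 1 ∧ u = 1 ∨ s = 3 ∧ (u = 1 ∨ u = 3) ∨ s = 7 ∧ (u = 1 ∨ u = 3 ∨ u = 7))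
    (ht : t = 0 ∨ t = 1 ∧ u = 1 ∨ t = 3 ∧ (s = 1 ∧ u = 1 ∨ s ≠ 1 ∧ u = 3) ∨
      t = 7 ∧ (s = 1 ∧ u = 1 ∨ s = 3 ∧ u = 3 ∨ s = 7 ∧ u = 7)) :
    (s = 3 ∧ t = 7 ∧ u = 3 ∧ (q = 5 ∧ r = 19 ∨ q = 7 ∧ r = 13)) ∨ (q = 3 ∧ s = 1 ∧ t ≠ 0) := by
  have hs7 : s ≤ 7 := by omega
  have ht7 : t ≤ 7 := by omega
  have hu7 : u ≤ 7 := by omega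
  -- If q ≥ 16, then 16r ≤ rs + qt + u ≤ 14r + 7, which is impossible. For each remaining q the
  -- equation is linear in r.
  have hq16 : q < 16 := by
    by_contra! hcon
    have h1 := Nat.mul_le_mul_right r hcon
    have h2 := Nat.mul_le_mul_left r hs7
    have h3 := Nat.mul_le_mul hqr.le ht7
    omega
  have hr2 : ¬ 2 ∣ r := by
    rw [Nat.prime_dvd_prime_iff_eq Nat.prime_two hr]; omega
  have hr3 : ¬ 3 ∣ r := by
    rw [Nat.prime_dvd_prime_iff_eq Nat.prime_three hr]; omega
  have hq' : q = 3 ∨ q = 5 ∨ q = 7 ∨ q = 11 ∨ q = 13 := by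
    interval_cases q <;> first | omega | (norm_num at hq)
  rcases hs with ⟨rfl, hu⟩ | ⟨rfl, hu⟩ | ⟨rfl, hu⟩ <;>
  rcases ht with rfl | ⟨rfl, ht⟩ | ⟨rfl, ht⟩ | ⟨rfl, ht⟩ <;>
  rcases hq' with rfl | rfl | rfl | rfl | rfl <;> omega

end Arithmetic

/-! ### Solving δ(G) = 2|G| when K exists -/

section Classification

variable {G : Type*} [Group G] {p q r : ℕ}

theorem normalSubgroupOrderSum_lt_of_three_le (hp : p.Prime) (hq : q.Prime) (hr : r.Prime)
    (hpq : p < q) (hqr : q < r) (hc : Nat.card G = p ^ 2 * (q * r)) (hp3 : 3 ≤ p)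
    (hD : HasDistributiveOrders G) : normalSubgroupOrderSum G < 2 * Nat.card G := by
  classical
  have hpos : 0 < p ^ 2 * (q * r) :=
    mul_pos (pow_pos hp.pos _) (mul_pos hq.pos hr.pos)
  have hfin : Finite G := Nat.finite_of_card_ne_zero (hc ▸ hpos.ne')
  have hq5 : 5 ≤ q := by
    have : q ≠ 4 := by rintro rfl; norm_num at hq
    omega
  have hr7 : 7 ≤ r := by
    have : r ≠ 6 := by rintro rfl; norm_num at hr
    omega
  rw [normalSubgroupOrderSum_eq_sum_divisors hD.card_injective]
  calc _ ≤ ∑ d ∈ (Nat.card G).divisors, d := by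
        refine Finset.sum_le_sum fun d _ => ?_
        split_ifs <;> omega
    _ = (1 + p + p ^ 2) * ((1 + q) * (1 + r)) := by
        rw [hc, sum_divisors_prime_sq_mul_mul hp hq hr hpq hqr]
        ring
    _ < _ := hc ▸ sigma_lt_two_mul hp3 hq5 hr7

/-- A Leinster group of order `4 * q * r` whose normal subgroups behave distributively has
order `4 * 5 * 19` or `4 * 7 * 13`, and normal subgroups of order `2` and `4 * q`, but none of
order `4`. -/
theorem eq_and_hasNormalOfCard_of_sum_eq (hq : q.Prime) (hr : r.Prime) (hq2 : 2 < q)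
    (hqr : q < r) (hc : Nat.card G = 2 ^ 2 * (q * r)) (hD : HasDistributiveOrders G)
    (h2qr : HasNormalOfCard G (2 * (q * r))) (hqr' : HasNormalOfCard G (q * r))
    (hnr : HasNormalOfCard G r)
    (h3 : q = 3 → HasNormalOfCard G q → HasNormalOfCard G (2 * r))
    (hsum : normalSubgroupOrderSum G = 2 * Nat.card G) :
    (q = 5 ∧ r = 19 ∨ q = 7 ∧ r = 13) ∧ HasNormalOfCard G 2 ∧ ¬ HasNormalOfCard G (2 ^ 2) ∧
      HasNormalOfCard G (2 ^ 2 * q) := by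
  classical
  have hfin : Finite G := Nat.finite_of_card_ne_zero (by
    rw [hc]; exact mul_ne_zero (by norm_num) (mul_ne_zero hq.ne_zero hr.ne_zero))
  have c2q : Nat.Coprime 2 q := (Nat.coprime_primes Nat.prime_two hq).mpr hq2.ne
  have c2r : Nat.Coprime 2 r := (Nat.coprime_primes Nat.prime_two hr).mpr (hq2.trans hqr).ne
  have cqr : Nat.Coprime q r := (Nat.coprime_primes hq hr).mpr hqr.ne
  have hgcd : ∀ x a b, Nat.Coprime a b → HasNormalOfCard G (x * a) → HasNormalOfCard G (x * b) →
      HasNormalOfCard G x := fun x a b hab ha hb => by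
    have := hD.gcd _ _ ha hb
    rwa [Nat.gcd_mul_left, hab.gcd_eq_one, mul_one] at this
  have hlcm : ∀ a b, Nat.Coprime a b → HasNormalOfCard G a → HasNormalOfCard G b →
      HasNormalOfCard G (a * b) := fun a b hab ha hb => by
    have := hD.lcm _ _ ha hb
    rwa [hab.lcm_eq_mul] at this
  rw [normalSubgroupOrderSum_eq_sum_divisors hD.card_injective, hc,
    sum_divisors_prime_sq_mul_mul Nat.prime_two hq hr hq2 hqr] at hsum
  have h1 : HasNormalOfCard G 1 := ⟨⊥, inferInstance, Subgroup.card_bot⟩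
  have htop : HasNormalOfCard G (2 ^ 2 * (q * r)) := ⟨⊤, inferInstance, by
    rw [Subgroup.card_top, hc]⟩
  -- With 0/1 indicators, closure under gcd and lcm becomes a system of linear inequalities.
  let x : ℕ → ℕ := fun d => if HasNormalOfCard G d then 1 else 0
  have hx : ∀ d, (if HasNormalOfCard G d then d else 0) = d * x d := fun d => by simp [x]
  have hx1 : ∀ d, HasNormalOfCard G d → x d = 1 := fun d hd => if_pos hd
  have hx' : ∀ d, x d = 1 → HasNormalOfCard G d := fun d hd => by
    by_contra hcon
    simp [x, hcon] at hd
  have hxle : ∀ d, x d ≤ 1 := fun d => by simp only [x]; split_ifs <;> omega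
  have himp : ∀ a b, (HasNormalOfCard G a → HasNormalOfCard G b) → x a ≤ x b := fun a b hab => by
    by_cases ha : HasNormalOfCard G a
    · rw [hx1 b (hab ha)]; exact hxle a
    · simp [x, ha]
  have himp2 : ∀ a b c, (HasNormalOfCard G a → HasNormalOfCard G b → HasNormalOfCard G c) →
      x a + x b ≤ 1 + x c := fun a b c hab => by
    by_cases ha : HasNormalOfCard G a
    · rw [hx1 a ha]
      exact Nat.add_le_add_left (himp b c (hab ha)) 1
    · have : x a = 0 := if_neg ha
      have := hxle b
      omega
  simp only [hx, hx1 _ h1, hx1 _ htop, hx1 _ h2qr, hx1 _ hqr', hx1 _ hnr] at hsum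
  have i1 : x (2 ^ 2 * r) ≤ x (2 * r) := himp _ _ fun h => hgcd (2 * r) 2 q c2q
    (by convert h using 1; ring) (by convert h2qr using 1; ring)
  have i2 : x (2 ^ 2 * q) ≤ x (2 * q) := himp _ _ fun h => hgcd (2 * q) 2 r c2r
    (by convert h using 1; ring) (by convert h2qr using 1; ring)
  have i3 : x (2 * q) ≤ x q := himp _ _ fun h => hgcd q 2 r c2r
    (by convert h using 1; ring) hqr'
  have i4 : x (2 ^ 2) ≤ x 2 := himp _ _ fun h => hgcd 2 2 (q * r) (c2q.mul_right c2r)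
    h h2qr
  have i5 : x 2 ≤ x (2 * r) := himp _ _ fun h => hlcm 2 r c2r h hnr
  have i6 : x (2 ^ 2) ≤ x (2 ^ 2 * r) := himp _ _ fun h => hlcm _ r (c2r.pow_left 2) h hnr
  have i7 : x (2 * r) + x (2 * q) ≤ 1 + x 2 := himp2 _ _ _ fun h h' => hgcd 2 r q cqr.symm h h'
  have i8 : x (2 ^ 2 * r) + x (2 ^ 2 * q) ≤ 1 + x (2 ^ 2) :=
    himp2 _ _ _ fun h h' => hgcd _ r q cqr.symm h h'
  have i9 : x 2 + x q ≤ 1 + x (2 * q) := himp2 _ _ _ fun h h' => hlcm 2 q c2q h h'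
  have i10 : x (2 ^ 2) + x q ≤ 1 + x (2 ^ 2 * q) :=
    himp2 _ _ _ fun h h' => hlcm _ q (c2q.pow_left 2) h h'
  have l1 := hxle (2 * r)
  have l2 := hxle q
  -- After cancelling 7qr, the coefficients of r, q and 1 are `s`, `t` and `u`; the inequalities
  -- restrict them to the listed values.
  have key := eq_of_mul_eq_add (s := 1 + 2 * x (2 * r) + 4 * x (2 ^ 2 * r))
    (t := x q + 2 * x (2 * q) + 4 * x (2 ^ 2 * q)) (u := 1 + 2 * x 2 + 4 * x (2 ^ 2))
    hq hr hq2 hqr (by linarith) (by omega) (by omega)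
  -- This excludes the spurious solutions: there `t ≠ 0` gives `x q = 1`, while `s = 1` gives `x (2
  -- * r) = 0`.
  have i11 : q = 3 → x q ≤ x (2 * r) := fun h => himp _ _ (h3 h)
  rcases key with ⟨hs, ht, hu, hqr0⟩ | ⟨hq3, hs, ht⟩
  · refine ⟨hqr0, hx' _ (by omega), fun h => ?_, hx' _ (by omega)⟩
    have := hx1 _ h
    omega
  · have := i11 hq3
    omega

/-- A normal subgroup of order `3` is centralized by a normal subgroup of index at most two. -/
theorem hasNormalOfCard_two_mul_of_three (hr : r.Prime) (hr3 : 3 < r)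
    (hc : Nat.card G = 2 ^ 2 * (3 * r)) (hD : HasDistributiveOrders G)
    (h2qr : HasNormalOfCard G (2 * (3 * r))) (h : HasNormalOfCard G 3) :
    HasNormalOfCard G (2 * r) := by
  have hfin : Finite G := Nat.finite_of_card_ne_zero (by
    rw [hc]; exact mul_ne_zero (by norm_num) (mul_ne_zero (by norm_num) hr.ne_zero))
  obtain ⟨Q, hQ, hQc⟩ := h
  have h3r : ¬ 3 ∣ r := by
    rw [Nat.prime_dvd_prime_iff_eq Nat.prime_three hr]; omega
  have c2r : Nat.Coprime 2 r := (Nat.coprime_primes Nat.prime_two hr).mpr (by omega)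
  have c3r : Nat.Coprime 3 r := (Nat.coprime_primes Nat.prime_three hr).mpr (by omega)
  have : Fact (Nat.Prime 3) := ⟨Nat.prime_three⟩
  have hcyc : IsCyclic Q := isCyclic_of_prime_card hQc
  let C := Subgroup.centralizer (Q : Set G)
  have hCn : C.Normal := inferInstance
  have hidx : C.index ∣ 2 := by
    have h1 : Nat.card (MulAut Q) = 2 := by
      rw [hcyc.card_mulAut, hQc]
      decide
    rw [← h1]
    have h2 : (MulAut.conjNormal : G →* MulAut Q).ker = C := by
      ext g
      simp only [MonoidHom.mem_ker, C, Subgroup.mem_centralizer_iff, MulEquiv.ext_iff,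
        Subtype.forall, Subtype.ext_iff, MulAut.conjNormal_apply, MulAut.one_apply,
        SetLike.mem_coe]
      refine forall₂_congr fun a _ => ?_
      rw [mul_inv_eq_iff_eq_mul, eq_comm]
    rw [← h2, Subgroup.index_ker]
    exact Subgroup.card_subgroup_dvd_card _
  have hQC : Q ≤ C := by
    rw [Subgroup.le_centralizer_iff_isMulCommutative]
    infer_instance
  have hcen : Q.subgroupOf C ≤ Subgroup.center C := by
    intro z hz
    rw [Subgroup.mem_center_iff]
    intro y
    exact Subtype.ext (y.2 z.1 hz).symm
  have hQC' : Nat.card (Q.subgroupOf C) = 3 := by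
    rw [Nat.card_congr (Subgroup.subgroupOfEquivOfLe hQC).toEquiv, hQc]
  have hCc := C.card_mul_index
  rw [hc] at hCc
  -- `Q` is central in `C`, so it has a normal complement there. If C = G, that complement has order
  -- 4r and meets the normal subgroup of order 6r in order 2r; if `C` has index 2, it already has
  -- order 2r.
  rcases (Nat.dvd_prime Nat.prime_two).mp hidx with h1 | h1 <;> rw [h1] at hCc
  · have hCc' : Nat.card C = 3 * (2 ^ 2 * r) := by omega
    have h3n : ¬ 3 ∣ 2 ^ 2 * r := by omega
    have h4r : HasNormalOfCard G (2 ^ 2 * r) := HasNormalOfCard.of_subgroup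
      (hasNormalOfCard_of_le_center Nat.prime_three hCc' h3n hQC' hcen)
      (hCc'.trans (mul_comm _ _)) ((Nat.prime_three.coprime_iff_not_dvd.mpr h3n).symm)
    have := hD.gcd _ _ h4r h2qr
    rwa [show 2 ^ 2 * r = 2 * r * 2 by ring, show 2 * (3 * r) = 2 * r * 3 by ring,
      Nat.gcd_mul_left, show Nat.gcd 2 3 = 1 from rfl, mul_one] at this
  · have hCc' : Nat.card C = 3 * (2 * r) := by omega
    have h3n : ¬ 3 ∣ 2 * r := by omega
    exact HasNormalOfCard.of_subgroup
      (hasNormalOfCard_of_le_center Nat.prime_three hCc' h3n hQC' hcen)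
      (hCc'.trans (mul_comm _ _)) ((Nat.prime_three.coprime_iff_not_dvd.mpr h3n).symm)

end Classification

/-! ### The exceptional order 12r, and the numerical classification -/

section Complement

variable {G : Type*} [Group G] {p q r : ℕ}

/-- Orders 2, 3, 6, 2r and 6r would each lead to a normal subgroup of order 3r. The remaining orders
1, r, 4, 4r, 12, 12r are Hall, so each occurs at most once, and their sum 17 + 17r is below 24r. -/
theorem normalSubgroupOrderSum_lt_of_not_hasNormalOfCard (hr : r.Prime) (hr3 : 3 < r)
    (hc : Nat.card G = 2 ^ 2 * (3 * r)) (h3r : ¬ HasNormalOfCard G (3 * r))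
    (hnr : HasNormalOfCard G r) : normalSubgroupOrderSum G < 2 * Nat.card G := by
  classical
  have hfin : Finite G := Nat.finite_of_card_ne_zero (by
    rw [hc]; exact mul_ne_zero (by norm_num) (mul_ne_zero (by norm_num) hr.ne_zero))
  have c2r : Nat.Coprime 2 r := (Nat.coprime_primes Nat.prime_two hr).mpr (by omega)
  have c3r : Nat.Coprime 3 r := (Nat.coprime_primes Nat.prime_three hr).mpr (by omega)
  have hodd : Odd (3 * r) := by
    rw [← Nat.coprime_two_left]
    exact Nat.Coprime.mul_right (by norm_num) c2r
  have h6r : ¬ HasNormalOfCard G (2 * (3 * r)) := by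
    rintro ⟨M, hM, hMc⟩
    exact h3r ((hasNormalOfCard_of_card_eq_two_mul hMc hodd).of_subgroup
      (hMc.trans (mul_comm _ _)) (Nat.coprime_two_right.mpr hodd))
  have h2r : ¬ HasNormalOfCard G (2 * r) := by
    rintro ⟨M, hM, hMc⟩
    have h1 : Nat.card (G ⧸ M) = 2 * 3 := by
      have := M.card_mul_index
      rw [Subgroup.index_eq_card, hMc, hc, show 2 ^ 2 * (3 * r) = 2 * r * (2 * 3) by ring] at this
      exact Nat.eq_of_mul_eq_mul_left (by have := hr.pos; omega) this
    have h2 := (hasNormalOfCard_of_card_eq_two_mul h1 (by decide)).of_quotient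
    rw [hMc, show 2 * r * 3 = 2 * (3 * r) by ring] at h2
    exact h6r h2
  have hmul : ∀ d, d.Coprime r → HasNormalOfCard G d → HasNormalOfCard G (d * r) := by
    rintro d hd ⟨N, hN, rfl⟩
    obtain ⟨R, hR, rfl⟩ := hnr
    refine ⟨N ⊔ R, inferInstance, ?_⟩
    have h1 := Subgroup.card_sup_mul_card_inf N R
    rwa [Nat.eq_one_of_dvd_coprimes hd (Subgroup.card_dvd_of_le inf_le_left)
      (Subgroup.card_dvd_of_le inf_le_right), mul_one] at h1
  have h2 : ¬ HasNormalOfCard G 2 := fun h => h2r (hmul _ c2r h)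
  have h3 : ¬ HasNormalOfCard G 3 := fun h => h3r (hmul _ c3r h)
  have h6 : ¬ HasNormalOfCard G (2 * 3) := fun h => h6r (by
    have := hmul _ (Nat.Coprime.mul_left c2r c3r) h
    rwa [mul_assoc] at this)
  have c4r : Nat.Coprime (2 ^ 2) r := c2r.pow_left 2
  have hhall : ∀ N : Subgroup G, N.Normal → (Nat.card N).Coprime N.index := by
    intro N hN
    have hN' : HasNormalOfCard G (Nat.card N) := ⟨N, hN, rfl⟩
    have hdvd : Nat.card N ∣ 2 ^ 2 * (3 * r) := hc ▸ N.card_subgroup_dvd_card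
    have hmulN := N.card_mul_index
    rw [hc] at hmulN
    obtain ⟨a, b, ha, hb, hab⟩ := (Nat.dvd_mul).mp hdvd
    obtain ⟨b1, b2, hb1, hb2, rfl⟩ := (Nat.dvd_mul).mp hb
    obtain ⟨k, hk, rfl⟩ := (Nat.dvd_prime_pow Nat.prime_two).mp ha
    rw [← hab] at hmulN hN' ⊢
    have hr0 := hr.pos
    have hfin : ∀ {x y z : ℕ}, 0 < x → x * y = 2 ^ 2 * (3 * r) → 2 ^ 2 * (3 * r) = x * z →
        x.Coprime z → x.Coprime y := fun hx h1 h2 h3 => by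
      rwa [Nat.eq_of_mul_eq_mul_left hx (h1.trans h2)]
    rcases (Nat.dvd_prime Nat.prime_three).mp hb1 with rfl | rfl <;>
    rcases (Nat.dvd_prime hr).mp hb2 with rfl | rfl <;>
    interval_cases k <;> try simp only [pow_zero, pow_one, one_mul, mul_one] at hN' hmulN ⊢
    all_goals first | exact absurd hN' ‹_› | skip
    · exact Nat.coprime_one_left _
    · exact hfin (by norm_num) hmulN rfl (Nat.Coprime.mul_right (by norm_num) c4r)
    · exact hfin hr0 hmulN (z := 2 ^ 2 * 3) (by ring)
        (Nat.Coprime.mul_right c4r.symm c3r.symm)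
    · exact hfin (by positivity) hmulN (z := 3) (by ring)
        (Nat.Coprime.mul_left (by norm_num) c3r.symm)
    · exact hfin (by positivity) hmulN (z := r) (by ring) (Nat.Coprime.mul_left c4r c3r)
    · exact hfin (by positivity) hmulN (z := 1) (by ring) (Nat.coprime_one_right _)
  rw [normalSubgroupOrderSum_eq_sum_divisors fun N M hN hM h =>
      Subgroup.eq_of_card_eq_of_coprime_index h (hhall M hM), hc,
    sum_divisors_prime_sq_mul_mul Nat.prime_two Nat.prime_three hr (by norm_num) hr3]
  simp only [if_neg h2, if_neg h3, if_neg h6, if_neg h2r, if_neg h3r, if_neg h6r]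
  have hle : ∀ d, (if HasNormalOfCard G d then d else 0) ≤ d := fun d => by
    split_ifs <;> omega
  have e1 := hle 1
  have e2 := hle r
  have e3 := hle (2 ^ 2)
  have e4 := hle (2 ^ 2 * r)
  have e5 := hle (2 ^ 2 * 3)
  have e6 := hle (2 ^ 2 * (3 * r))
  omega

/-- Since δ(G) is even, some nontrivial normal subgroup has odd order 3, r or 3r. Order 3 lifts to
3r through the normal Sylow r-subgroup of the quotient of order 4r; order r without 3r makes δ(G)
too small. -/
theorem hasNormalOfCard_three_mul_of_sum_eq (hr : r.Prime) (hr3 : 3 < r)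
    (hc : Nat.card G = 2 ^ 2 * (3 * r)) (hsum : normalSubgroupOrderSum G = 2 * Nat.card G) :
    HasNormalOfCard G (3 * r) := by
  have hfin : Finite G := Nat.finite_of_card_ne_zero (by
    rw [hc]; exact mul_ne_zero (by norm_num) (mul_ne_zero (by norm_num) hr.ne_zero))
  by_contra h3r
  have h1 : ∃ N : Subgroup G, N.Normal ∧ Odd (Nat.card N) ∧ N ≠ ⊥ := by
    by_contra! hcon
    have := odd_normalSubgroupOrderSum hcon
    rw [hsum] at this
    exact Nat.not_odd_iff_even.mpr (even_two_mul _) this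
  obtain ⟨N, hN, hNo, hNb⟩ := h1
  have hdvd : Nat.card N ∣ 3 * r := by
    have h2 : Nat.card N ∣ 2 ^ 2 * (3 * r) := hc ▸ N.card_subgroup_dvd_card
    exact ((Nat.coprime_two_right.mpr hNo).pow_right 2).dvd_of_dvd_mul_left h2
  obtain ⟨b1, b2, hb1, hb2, hb⟩ := (Nat.dvd_mul).mp hdvd
  rcases (Nat.dvd_prime Nat.prime_three).mp hb1 with rfl | rfl <;>
  rcases (Nat.dvd_prime hr).mp hb2 with rfl | rfl
  · exact hNb (Subgroup.card_eq_one.mp hb.symm)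
  · have h2 := normalSubgroupOrderSum_lt_of_not_hasNormalOfCard hr hr3 hc h3r
      ⟨N, hN, hb.symm.trans (one_mul _)⟩
    exact h2.ne hsum
  · have hN3 : Nat.card N = 3 := hb.symm
    have h2 : Nat.card (G ⧸ N) = r ^ 1 * 2 ^ 2 := by
      have := N.card_mul_index
      rw [Subgroup.index_eq_card, hN3, hc] at this
      rw [pow_one]
      omega
    have h3 : HasNormalOfCard (G ⧸ N) (r ^ 1) := by
      refine hasNormalOfCard_prime_pow hr h2 (fun h => ?_) fun d hd hmod => ?_
      · have := Nat.le_of_dvd (by norm_num) (hr.dvd_of_dvd_pow h)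
        omega
      · have h4 : d ≤ 4 := Nat.le_of_dvd (by norm_num) hd
        have h5 : d < r := by
          have : r ≠ 4 := by rintro rfl; norm_num at hr
          omega
        rwa [Nat.ModEq, Nat.mod_eq_of_lt h5, Nat.mod_eq_of_lt hr.one_lt] at hmod
    have h4 := h3.of_quotient
    rw [hN3, pow_one] at h4
    exact h3r h4
  · exact h3r ⟨N, hN, hb.symm⟩

theorem hasNormalOfCard_mul_of_ne (hp : p.Prime) (hq : q.Prime) (hr : r.Prime)
    (hpq : p < q) (hqr : q < r) (hc : Nat.card G = p ^ 2 * (q * r)) (hne : p = 2 → q ≠ 3) :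
    HasNormalOfCard G (q * r) := by
  refine hasNormalOfCard_of_card_eq_prime_sq_mul hp hc (fun ℓ hℓ hd => ?_) fun h2 h3 => ?_
  · rw [hℓ.dvd_mul, Nat.prime_dvd_prime_iff_eq hℓ hq, Nat.prime_dvd_prime_iff_eq hℓ hr] at hd
    omega
  · rw [Nat.prime_three.dvd_mul, Nat.prime_dvd_prime_iff_eq Nat.prime_three hq,
      Nat.prime_dvd_prime_iff_eq Nat.prime_three hr] at h3
    have := hne h2
    omega

theorem hasNormalOfCard_mul_of_sum_eq (hp : p.Prime) (hq : q.Prime) (hr : r.Prime)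
    (hpq : p < q) (hqr : q < r) (hc : Nat.card G = p ^ 2 * (q * r))
    (hsum : normalSubgroupOrderSum G = 2 * Nat.card G) : HasNormalOfCard G (q * r) := by
  by_cases h : p = 2 ∧ q = 3
  · obtain ⟨rfl, rfl⟩ := h
    exact hasNormalOfCard_three_mul_of_sum_eq hr hqr hc hsum
  · exact hasNormalOfCard_mul_of_ne hp hq hr hpq hqr hc fun h1 h2 => h ⟨h1, h2⟩

theorem isCyclic_quotient_of_sum_eq (hp : p.Prime) [Finite G] {m : ℕ}
    (hc : Nat.card G = p ^ 2 * m) (hsum : normalSubgroupOrderSum G = 2 * Nat.card G)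
    {K : Subgroup G} [K.Normal] (hK : Nat.card K = m) : IsCyclic (G ⧸ K) := by
  have := Fact.mk hp
  have hQ : Nat.card (G ⧸ K) = p ^ 2 := by
    have h1 := K.card_mul_index
    rw [Subgroup.index_eq_card, hK, hc, mul_comm] at h1
    exact Nat.eq_of_mul_eq_mul_right (hK ▸ Nat.card_pos) h1
  have hcomm : IsMulCommutative (G ⧸ K) := IsPGroup.isMulCommutative_of_card_eq_prime_sq hQ
  obtain ⟨g, hg⟩ := exists_forall_normal_eq_top hsum.le
  exact ⟨(g : G ⧸ K), mem_zpowers_of_forall_normal_eq_top hg K⟩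

/-- The numerical part of the classification of Leinster groups of order `p ^ 2 * q * r`. -/
theorem classification_of_sum_eq (hp : p.Prime) (hq : q.Prime) (hr : r.Prime)
    (hpq : p < q) (hqr : q < r) (hc : Nat.card G = p ^ 2 * (q * r))
    (hsum : normalSubgroupOrderSum G = 2 * Nat.card G) :
    p = 2 ∧ (q = 5 ∧ r = 19 ∨ q = 7 ∧ r = 13) ∧ HasNormalOfCard G r ∧ HasNormalOfCard G 2 ∧
      ¬ HasNormalOfCard G (2 ^ 2) ∧ HasNormalOfCard G (2 ^ 2 * q) ∧ ∃ x : G, orderOf x = 4 := by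
  have hfin : Finite G := Nat.finite_of_card_ne_zero (by
    rw [hc]
    exact mul_ne_zero (pow_ne_zero _ hp.ne_zero) (mul_ne_zero hq.ne_zero hr.ne_zero))
  have hqr' := hasNormalOfCard_mul_of_sum_eq hp hq hr hpq hqr hc hsum
  have hnr := hasNormalOfCard_of_mul hq hr hqr hqr'
  obtain ⟨K, hKn, hK⟩ := id hqr'
  have hcyc := isCyclic_quotient_of_sum_eq hp hc hsum hK
  obtain ⟨hD, hpqr⟩ := hasDistributiveOrders_of_isCyclic hp hq hr hpq hqr hc hK
  have hp2 : p = 2 := by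
    by_contra hne
    have h3 : 3 ≤ p := by have := hp.two_le; omega
    exact (normalSubgroupOrderSum_lt_of_three_le hp hq hr hpq hqr hc h3 hD).ne hsum
  subst hp2
  -- A lift of a generator of G/K has order divisible by 4, so a power of it has order 4.
  have hx : ∃ x : G, orderOf x = 4 := by
    obtain ⟨y, hy⟩ := IsCyclic.exists_generator (α := G ⧸ K)
    obtain ⟨g, rfl⟩ := QuotientGroup.mk'_surjective K y
    have h1 := orderOf_eq_card_of_forall_mem_zpowers hy
    have h2 := K.card_mul_index
    rw [Subgroup.index_eq_card, ← h1, hK, hc, mul_comm] at h2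
    have h3 := Nat.eq_of_mul_eq_mul_right (mul_pos hq.pos hr.pos) h2
    have h4 := orderOf_map_dvd (QuotientGroup.mk' K) g
    rw [h3] at h4
    exact ⟨_, orderOf_pow_orderOf_div (orderOf_pos g).ne' h4⟩
  obtain ⟨h1, h2, h3, h4⟩ := eq_and_hasNormalOfCard_of_sum_eq hq hr hpq hqr hc hD hpqr hqr' hnr
    (fun h h' => by
      subst h
      exact hasNormalOfCard_two_mul_of_three hr hqr hc hD hpqr h') hsum
  exact ⟨rfl, h1, hnr, h2, h3, h4, hx⟩

end Complement

/-! ### Recognizing the dicyclic group -/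

section Quaternion

variable {H : Type*} [Group H]

/-- A group of order `4 * n` satisfying the relations of the dicyclic group is isomorphic
to it. -/
theorem nonempty_mulEquiv_quaternionGroup {n : ℕ} (hn : 2 ≤ n) (hc : Nat.card H = 4 * n)
    {A x : H} (hA : orderOf A = 2 * n) (hx : x ^ 2 = A ^ n) (hxA : x * A * x⁻¹ = A⁻¹) :
    Nonempty (H ≃* QuaternionGroup n) := by
  have hnz : NeZero n := ⟨by omega⟩
  have hfin : Finite H := Nat.finite_of_card_ne_zero (by omega)
  have hsemi : ∀ k : ℤ, A ^ k * x = x * A ^ (-k) := fun k => by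
    have h : SemiconjBy x A A⁻¹ := by rw [SemiconjBy, ← hxA]; group
    have := h.zpow_right (-k)
    rw [SemiconjBy, inv_zpow', neg_neg] at this
    exact this.symm
  let φ : ZMod (2 * n) →+ Additive H := ZMod.lift (2 * n)
    ⟨zmultiplesHom (Additive H) (Additive.ofMul A), by
      rw [zmultiplesHom_apply, ← ofMul_zpow, zpow_natCast, ← hA, pow_orderOf_eq_one, ofMul_one]⟩
  let F : ZMod (2 * n) → H := fun i => (φ i).toMul
  have hF : ∀ k : ℤ, F k = A ^ k := fun k => by
    simp only [F, φ]
    rw [ZMod.lift_coe, zmultiplesHom_apply, ← ofMul_zpow, toMul_ofMul]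
  have hFadd : ∀ i j, F (i + j) = F i * F j := fun i j => by simp [F]
  have hFx : ∀ i, F i * x = x * F (-i) := fun i => by
    obtain ⟨k, rfl⟩ := ZMod.intCast_surjective i
    rw [← Int.cast_neg, hF, hF, hsemi]
  have hFn : F n = x ^ 2 := by
    have := hF n
    rwa [Int.cast_natCast, zpow_natCast, ← hx] at this
  have hF1 : ∀ i, F i = 1 → i = 0 := fun i hi => by
    obtain ⟨k, rfl⟩ := ZMod.intCast_surjective i
    rw [hF, ← orderOf_dvd_iff_zpow_eq_one, hA] at hi
    exact (ZMod.intCast_zmod_eq_zero_iff_dvd _ _).mpr hi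
  let f : QuaternionGroup n →* H := MonoidHom.mk'
    (fun g => match g with
      | QuaternionGroup.a i => F i
      | QuaternionGroup.xa i => x * F i) (by
    rintro (i | i) (j | j)
    · exact hFadd i j
    · change x * F (j - i) = F i * (x * F j)
      rw [← mul_assoc, hFx, mul_assoc, ← hFadd, neg_add_eq_sub]
    · change x * F (i + j) = x * F i * F j
      rw [hFadd, mul_assoc]
    · change F (n + j - i) = x * F i * (x * F j)
      rw [mul_assoc, ← mul_assoc (F i), hFx, mul_assoc, ← hFadd, ← mul_assoc, ← sq, ← hFn,
        ← hFadd, neg_add_eq_sub, add_sub_assoc])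
  have hinj : Function.Injective f := by
    rw [injective_iff_map_eq_one]
    rintro (i | i) hi
    · rw [hF1 i hi, QuaternionGroup.a_zero]
    · exfalso
      have h1 : x = F (-i) := by
        have h2 : x * F i = 1 := hi
        have h3 : F i * F (-i) = 1 := by rw [← hFadd, add_neg_cancel]; simp [F]
        rw [eq_inv_of_mul_eq_one_left h2, eq_comm]
        exact eq_inv_of_mul_eq_one_right h3
      obtain ⟨k, hk⟩ := ZMod.intCast_surjective (-i)
      rw [← hk, hF] at h1
      -- If x were a power of A, it would commute with A and the relation would give A = A⁻¹,
      -- against order 2n ≥ 4.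
      have h2 : A * A = 1 := by
        rw [h1, ((Commute.refl A).zpow_left k).eq, mul_inv_cancel_right] at hxA
        exact mul_eq_one_iff_eq_inv.mpr hxA
      have h3 := orderOf_dvd_of_pow_eq_one ((sq A).trans h2)
      rw [hA] at h3
      have := Nat.le_of_dvd two_pos h3
      omega
  have hbij : Function.Bijective f := by
    rw [Nat.bijective_iff_injective_and_card]
    exact ⟨hinj, by rw [Nat.card_eq_fintype_card, QuaternionGroup.card, hc]⟩
  exact ⟨(MulEquiv.ofBijective f hbij).symm⟩

theorem nonempty_mulEquiv_quaternionGroup_of_hasNormalOfCard {q : ℕ} (hq : q.Prime)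
    (hq2 : 2 < q) (hc : Nat.card H = 2 ^ 2 * q) (hQ : HasNormalOfCard H q)
    (hZ : HasNormalOfCard H 2) (h4 : ¬ HasNormalOfCard H (2 ^ 2)) {x : H} (hx : orderOf x = 4) :
    Nonempty (H ≃* QuaternionGroup q) := by
  have hfin : Finite H := Nat.finite_of_card_ne_zero (by have := hq.pos; omega)
  have c2q : Nat.Coprime 2 q := (Nat.coprime_primes Nat.prime_two hq).mpr hq2.ne
  have hqodd : Odd q := Nat.coprime_two_left.mp c2q
  obtain ⟨Q, hQn, hQc⟩ := hQ
  obtain ⟨Z, hZn, hZc⟩ := hZ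
  have hP : Nat.card (Subgroup.zpowers x) = 4 := by rw [Nat.card_zpowers, hx]
  have hx2 : x ^ 2 ≠ 1 := fun h => by
    have := orderOf_dvd_of_pow_eq_one h
    rw [hx] at this
    norm_num at this
  have hx4 : x ^ 4 = 1 := hx ▸ pow_orderOf_eq_one x
  -- Otherwise the join would have order 8, which does not divide 4q. Hence `x ^ 2` is the
  -- involution of the normal subgroup `Z`, and it is central.
  have hZP : Z ≤ Subgroup.zpowers x := by
    have h1 := Subgroup.card_sup_mul_card_inf (Subgroup.zpowers x) Z
    rw [hP, hZc] at h1
    have h2 : Nat.card (Subgroup.zpowers x ⊓ Z : Subgroup H) ∣ 2 :=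
      hZc ▸ Subgroup.card_dvd_of_le inf_le_right
    rcases (Nat.dvd_prime Nat.prime_two).mp h2 with h3 | h3
    · exfalso
      rw [h3] at h1
      have h5 := Subgroup.card_subgroup_dvd_card (Subgroup.zpowers x ⊔ Z)
      rw [show Nat.card (Subgroup.zpowers x ⊔ Z : Subgroup H) = 2 ^ 2 * 2 by omega, hc] at h5
      have h6 := Nat.dvd_of_mul_dvd_mul_left (by norm_num) h5
      rw [Nat.prime_dvd_prime_iff_eq Nat.prime_two hq] at h6
      omega
    · have h5 : Subgroup.zpowers x ⊓ Z = Z :=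
        Subgroup.eq_of_le_of_card_ge inf_le_right (by rw [h3, hZc])
      exact inf_eq_right.mp h5
  have hZx : x ^ 2 ∈ Z := by
    classical
    obtain ⟨⟨z, hzZ⟩, hz⟩ := exists_prime_orderOf_dvd_card' (G := Z) 2 (by rw [hZc])
    rw [← Subgroup.orderOf_coe] at hz
    change orderOf z = 2 at hz
    have hz1 : z ≠ 1 := fun h => by
      rw [h, orderOf_one] at hz
      omega
    have hz2 : z ^ 2 = 1 := hz ▸ pow_orderOf_eq_one z
    obtain ⟨k, hk, hkz⟩ := (mem_zpowers_iff_mem_range_orderOf.mp (hZP hzZ)) |>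
      fun h => by simpa using h
    rw [hx] at hk
    rw [← hkz] at hz1 hz2 hzZ
    interval_cases k
    · simp at hz1
    · exact absurd (by simpa using hz2) hx2
    · exact hzZ
    · rw [← pow_mul, show x ^ (3 * 2) = x ^ 4 * x ^ 2 by rw [← pow_add], hx4, one_mul] at hz2
      exact absurd hz2 hx2
  have hcen : ∀ h : H, Commute h (x ^ 2) := by
    intro h
    have h1 := hZn.conj_mem _ hZx h
    by_contra hne
    have h2 : h * x ^ 2 * h⁻¹ ≠ x ^ 2 := fun he => hne (by
      rw [mul_inv_eq_iff_eq_mul] at he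
      exact he)
    have h3 : ({1, x ^ 2, h * x ^ 2 * h⁻¹} : Set H) ⊆ Z := by
      rintro y (rfl | rfl | rfl)
      exacts [one_mem Z, hZx, h1]
    have h5 : ({1, x ^ 2, h * x ^ 2 * h⁻¹} : Set H).ncard = 3 := by
      rw [Set.ncard_eq_three]
      refine ⟨_, _, _, hx2.symm, fun he => hx2 ?_, h2.symm, rfl⟩
      rwa [eq_comm, conj_eq_one_iff] at he
    have h6 := Set.ncard_le_ncard h3
    rw [h5] at h6
    have h7 : (Z : Set H).ncard = 2 := hZc
    omega
  have := Fact.mk hq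
  have hQcyc : IsCyclic Q := isCyclic_of_prime_card hQc
  obtain ⟨⟨b, hbQ⟩, hb⟩ := hQcyc.exists_generator
  have hbo : orderOf b = q := by
    have := orderOf_eq_card_of_forall_mem_zpowers hb
    rwa [← Subgroup.orderOf_coe, hQc] at this
  have hbz : ∀ y ∈ Q, ∃ k : ℤ, b ^ k = y := fun y hy => by
    obtain ⟨k, hk⟩ := hb ⟨y, hy⟩
    exact ⟨k, by simpa using congrArg Subtype.val hk⟩
  -- If `x` centralized `Q`, the subgroup generated by `x` would be normal of order 4.
  have hnc : ¬ Commute x b := by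
    intro hcomm
    refine h4 ⟨Subgroup.zpowers x, ?_, hP⟩
    rw [← Subgroup.normalizer_eq_top_iff, ← top_le_iff]
    have h1 : Subgroup.zpowers x ⊔ Q = ⊤ := by
      refine Subgroup.eq_top_of_card_eq _ ?_
      have h1 := Subgroup.card_sup_mul_card_inf (Subgroup.zpowers x) Q
      have h2 : (Nat.card (Subgroup.zpowers x)).Coprime (Nat.card Q) := by
        rw [hP, hQc]; exact c2q.pow_left 2
      rw [Nat.eq_one_of_dvd_coprimes h2 (Subgroup.card_dvd_of_le inf_le_left)
        (Subgroup.card_dvd_of_le inf_le_right), mul_one, hP, hQc] at h1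
      rw [h1, hc]
      norm_num
    rw [← h1]
    refine sup_le Subgroup.le_normalizer fun y hy => ?_
    obtain ⟨k, rfl⟩ := hbz y hy
    refine Subgroup.centralizer_le_normalizer _ ?_
    rw [Subgroup.mem_centralizer_iff]
    rintro _ ⟨j, rfl⟩
    exact (hcomm.zpow_zpow j k).eq
  obtain ⟨k, hk⟩ := hbz _ (hQn.conj_mem b hbQ x)
  -- Conjugation by `x` is b ↦ b^k with k² ≡ 1 mod q because `x ^ 2` is central; k ≡ 1 is excluded,
  -- so k ≡ -1.
  have hconj : x * b * x⁻¹ = b⁻¹ := by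
    have h1 : b ^ (k * k) = b := by
      rw [zpow_mul, hk, conj_zpow, hk]
      have := (hcen b).eq
      rw [show x * (x * b * x⁻¹) * x⁻¹ = x ^ 2 * b * (x ^ 2)⁻¹ by
        simp only [sq, mul_inv_rev, mul_assoc], ← this,
        mul_inv_cancel_right]
    have h2 : b ^ ((k - 1) * (k + 1)) = 1 := by
      rw [show (k - 1) * (k + 1) = k * k - 1 by ring, zpow_sub_one, h1, mul_inv_cancel]
    rw [← orderOf_dvd_iff_zpow_eq_one, hbo] at h2
    rcases (Nat.prime_iff_prime_int.mp hq).dvd_mul.mp h2 with h3 | h3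
    · exfalso
      rw [← hbo, orderOf_dvd_iff_zpow_eq_one, zpow_sub_one, hk, mul_inv_eq_one,
        mul_inv_eq_iff_eq_mul] at h3
      exact hnc h3
    · rw [← hbo, orderOf_dvd_iff_zpow_eq_one, zpow_add_one, hk] at h3
      exact eq_inv_of_mul_eq_one_left h3
  have hzo : orderOf (x ^ 2) = 2 := by
    rw [orderOf_pow, hx]
    norm_num
  have hbc : Commute b (x ^ 2) := hcen b
  -- The factor `x ^ 2` raises the order from q to 2q, and A^q = x^(2q) = x² since q is odd.
  refine nonempty_mulEquiv_quaternionGroup (A := b * x ^ 2) (x := x) hq2.le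
    (by omega) ?_ ?_ ?_
  · rw [hbc.orderOf_mul_eq_mul_orderOf_of_coprime (by rw [hbo, hzo]; exact c2q.symm), hbo, hzo,
      mul_comm]
  · obtain ⟨j, hj⟩ := hqodd
    rw [hbc.mul_pow, ← hbo, pow_orderOf_eq_one, one_mul, hbo, hj, ← pow_mul,
      show 2 * (2 * j + 1) = 4 * j + 2 by ring, pow_add, pow_mul, hx4, one_pow, one_mul]
  · rw [← mul_assoc, mul_inv_rev, ← (hbc.inv_inv).eq, ← hconj]
    have : x ^ 2 = (x ^ 2)⁻¹ := by
      rw [eq_inv_iff_mul_eq_one, ← pow_add, hx4]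
    rw [← this]
    group

end Quaternion

/-- A group with normal subgroups of coprime orders `m` and `n` and order `m * n` is their
direct product. -/
theorem nonempty_mulEquiv_prod {G : Type*} [Group G] [Finite G] {H R : Subgroup G} [H.Normal]
    [R.Normal] (hc : Nat.card G = Nat.card H * Nat.card R)
    (hcop : (Nat.card H).Coprime (Nat.card R)) : Nonempty (G ≃* H × R) := by
  have hdis : Disjoint H R := disjoint_iff.mpr <| Subgroup.card_eq_one.mp <|
    Nat.eq_one_of_dvd_coprimes hcop (Subgroup.card_dvd_of_le inf_le_left)
      (Subgroup.card_dvd_of_le inf_le_right)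
  let f : H × R →* G := MonoidHom.noncommCoprod H.subtype R.subtype fun h r =>
    Subgroup.commute_of_normal_of_disjoint H R inferInstance inferInstance hdis _ _ h.2 r.2
  have hinj : Function.Injective f := by
    rw [injective_iff_map_eq_one]
    rintro ⟨h, r⟩ (he : (h : G) * r = 1)
    have h1 : (h : G) = (r : G)⁻¹ := eq_inv_of_mul_eq_one_left he
    have h2 : (h : G) = 1 := by
      have : (h : G) ∈ H ⊓ R := ⟨h.2, by rw [h1]; exact R.inv_mem r.2⟩
      rwa [disjoint_iff.mp hdis, Subgroup.mem_bot] at this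
    have h3 : (r : G) = 1 := by rwa [h2, one_mul] at he
    exact Prod.ext (Subtype.ext h2) (Subtype.ext h3)
  have hbij : Function.Bijective f := by
    rw [Nat.bijective_iff_injective_and_card]
    exact ⟨hinj, by rw [Nat.card_prod, hc]⟩
  exact ⟨(MulEquiv.ofBijective f hbij).symm⟩

/-! ### Product decomposition, and δ of the product groups -/

section Converse

theorem HasNormalOfCard.subgroup {G : Type*} [Group G] {H : Subgroup G} {d : ℕ}
    {N : Subgroup G} [N.Normal] (hd : Nat.card N = d) (hle : N ≤ H) : HasNormalOfCard H d :=
  ⟨N.subgroupOf H, inferInstance, by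
    rw [Nat.card_congr (Subgroup.subgroupOfEquivOfLe hle).toEquiv, hd]⟩

/-- The Leinster groups of order `4 * q * r` are products of a dicyclic and a cyclic group. -/
theorem nonempty_mulEquiv_quaternionGroup_prod {G : Type*} [Group G] {q r : ℕ} (hq : q.Prime)
    (hr : r.Prime) (hq2 : 3 < q) (hqr : q < r) (hc : Nat.card G = 2 ^ 2 * (q * r))
    (hR : HasNormalOfCard G r) (hZ : HasNormalOfCard G 2) (h4 : ¬ HasNormalOfCard G (2 ^ 2))
    (hH : HasNormalOfCard G (2 ^ 2 * q)) (hx : ∃ x : G, orderOf x = 4) :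
    Nonempty (G ≃* QuaternionGroup q × Multiplicative (ZMod r)) := by
  have hfin : Finite G := Nat.finite_of_card_ne_zero (by
    rw [hc]; exact mul_ne_zero (by norm_num) (mul_ne_zero hq.ne_zero hr.ne_zero))
  have := Fact.mk hr
  have c2q : Nat.Coprime 2 q := (Nat.coprime_primes Nat.prime_two hq).mpr (by omega)
  have c2r : Nat.Coprime 2 r := (Nat.coprime_primes Nat.prime_two hr).mpr (by omega)
  have cqr : Nat.Coprime q r := (Nat.coprime_primes hq hr).mpr hqr.ne
  obtain ⟨R, hRn, hRc⟩ := hR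
  obtain ⟨Z, hZn, hZc⟩ := hZ
  obtain ⟨H, hHn, hHc⟩ := hH
  obtain ⟨x, hx⟩ := hx
  have hHi : H.index = r := by
    have h1 := H.card_mul_index
    rw [hHc, hc, ← mul_assoc] at h1
    exact Nat.eq_of_mul_eq_mul_left (mul_pos (by norm_num) hq.pos) h1
  have hxH : x ∈ H := by
    have h1 : Subgroup.zpowers x ≤ H := Subgroup.le_of_coprime_card_index (by
      rw [Nat.card_zpowers, hx, hHi]; exact c2r.pow_left 2)
    exact h1 (Subgroup.mem_zpowers x)
  have hZH : Z ≤ H := Subgroup.le_of_coprime_card_index (by rw [hZc, hHi]; exact c2r)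
  have hQ : HasNormalOfCard H q := by
    refine hasNormalOfCard_of_card_eq_prime_sq_mul Nat.prime_two hHc (fun ℓ hℓ hd => ?_) fun _ h3 => ?_
    · rw [Nat.prime_dvd_prime_iff_eq hℓ hq] at hd
      omega
    · rw [Nat.prime_dvd_prime_iff_eq Nat.prime_three hq] at h3
      omega
  obtain ⟨e⟩ := nonempty_mulEquiv_quaternionGroup_of_hasNormalOfCard hq (by omega) hHc hQ
    (HasNormalOfCard.subgroup hZc hZH) (fun h => h4 (h.of_subgroup hHc (c2q.pow_left 2)))
    (x := ⟨x, hxH⟩) (by rw [← Subgroup.orderOf_coe, hx])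
  obtain ⟨e'⟩ := nonempty_mulEquiv_prod (H := H) (R := R) (by rw [hHc, hRc, hc]; ring)
    (by rw [hHc, hRc]; exact Nat.Coprime.mul_left (c2r.pow_left 2) cqr)
  have e'' : R ≃* Multiplicative (ZMod r) :=
    mulEquivOfPrimeCardEq (p := r) hRc (by simp)
  exact ⟨e'.trans (e.prodCongr e'')⟩

/-- The sum of the orders of the normal subgroups of a group of order `4 * q * r` with the
normal subgroups found in the product of a dicyclic and a cyclic group. -/
theorem normalSubgroupOrderSum_eq_of_hasNormalOfCard {G : Type*} [Group G] {q r : ℕ}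
    (hq : q.Prime) (hr : r.Prime) (hq2 : 3 < q) (hqr : q < r)
    (hc : Nat.card G = 2 ^ 2 * (q * r)) (hR : HasNormalOfCard G r) (hZ : HasNormalOfCard G 2)
    (h4 : ¬ HasNormalOfCard G (2 ^ 2)) (hH : HasNormalOfCard G (2 ^ 2 * q))
    (hx : ∃ x : G, orderOf x = 4) :
    normalSubgroupOrderSum G = 7 * (q * r) + 7 * q + 3 * r + 3 := by
  classical
  have hfin : Finite G := Nat.finite_of_card_ne_zero (by
    rw [hc]; exact mul_ne_zero (by norm_num) (mul_ne_zero hq.ne_zero hr.ne_zero))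
  have c2q : Nat.Coprime 2 q := (Nat.coprime_primes Nat.prime_two hq).mpr (by omega)
  have c2r : Nat.Coprime 2 r := (Nat.coprime_primes Nat.prime_two hr).mpr (by omega)
  have cqr : Nat.Coprime q r := (Nat.coprime_primes hq hr).mpr hqr.ne
  have hqr' := hasNormalOfCard_mul_of_ne Nat.prime_two hq hr (by omega) hqr hc
    fun _ => by omega
  obtain ⟨K, hKn, hK⟩ := id hqr'
  have hcyc : IsCyclic (G ⧸ K) := by
    obtain ⟨x, hx⟩ := hx
    have hQ : Nat.card (G ⧸ K) = 4 := by
      have h1 := K.card_mul_index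
      rw [Subgroup.index_eq_card, hK, hc, mul_comm] at h1
      exact Nat.eq_of_mul_eq_mul_right (mul_pos hq.pos hr.pos) h1
    refine isCyclic_of_orderOf_eq_card (x : G ⧸ K) ?_
    rw [hQ]
    have h1 : orderOf (x : G ⧸ K) ∣ 2 ^ 2 := by
      have := orderOf_map_dvd (QuotientGroup.mk' K) x
      rwa [hx] at this
    obtain ⟨k, hk, hk'⟩ := (Nat.dvd_prime_pow Nat.prime_two).mp h1
    -- Otherwise x², of order 2, would lie in `K`, whose order is odd.
    by_contra hne
    have hk1 : k ≤ 1 := by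
      by_contra hk2
      have : k = 2 := by omega
      exact hne (hk'.trans (by rw [this]; norm_num))
    have h2 : (x : G ⧸ K) ^ 2 = 1 := by
      rw [← orderOf_dvd_iff_pow_eq_one, hk']
      exact pow_dvd_pow 2 hk1
    rw [← QuotientGroup.mk_pow, QuotientGroup.eq_one_iff] at h2
    have h3 := Subgroup.orderOf_dvd_natCard K h2
    rw [orderOf_pow, hx, hK] at h3
    exact absurd (Nat.eq_one_of_dvd_coprimes (c2q.mul_right c2r) (by norm_num) h3)
      (by norm_num)
  obtain ⟨hD, h2qr⟩ := hasDistributiveOrders_of_isCyclic Nat.prime_two hq hr (by omega) hqr hc hK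
  have hgcd : ∀ x a b, Nat.Coprime a b → HasNormalOfCard G (x * a) → HasNormalOfCard G (x * b) →
      HasNormalOfCard G x := fun x a b hab ha hb => by
    have := hD.gcd _ _ ha hb
    rwa [Nat.gcd_mul_left, hab.gcd_eq_one, mul_one] at this
  have h1 : HasNormalOfCard G 1 := ⟨⊥, inferInstance, Subgroup.card_bot⟩
  have htop : HasNormalOfCard G (2 ^ 2 * (q * r)) := ⟨⊤, inferInstance, by
    rw [Subgroup.card_top, hc]⟩
  have h2q : HasNormalOfCard G (2 * q) := hgcd (2 * q) 2 r c2r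
    (by convert hH using 1; ring) (by convert h2qr using 1; ring)
  have hnq : HasNormalOfCard G q := hgcd q 2 r c2r (by convert h2q using 1; ring) hqr'
  have h2r : HasNormalOfCard G (2 * r) := c2r.lcm_eq_mul ▸ hD.lcm _ _ hZ hR
  have h4r : ¬ HasNormalOfCard G (2 ^ 2 * r) := fun h => h4 (hgcd _ r q cqr.symm h hH)
  rw [normalSubgroupOrderSum_eq_sum_divisors hD.card_injective, hc,
    sum_divisors_prime_sq_mul_mul Nat.prime_two hq hr (by omega) hqr]
  simp only [if_pos h1, if_pos htop, if_pos h2q, if_pos hnq, if_pos h2r, if_neg h4r, if_neg h4,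
    if_pos hR, if_pos hZ, if_pos hH, if_pos hqr', if_pos h2qr]
  ring

theorem card_quaternionGroup_prod {q r : ℕ} [NeZero q] :
    Nat.card (QuaternionGroup q × Multiplicative (ZMod r)) = 2 ^ 2 * (q * r) := by
  rw [Nat.card_prod, Nat.card_eq_fintype_card, QuaternionGroup.card]
  have : Nat.card (Multiplicative (ZMod r)) = r :=
    (Nat.card_congr Multiplicative.toAdd).trans (Nat.card_zmod r)
  rw [this]
  ring

theorem normalSubgroupOrderSum_quaternionGroup_prod {q r : ℕ} (hq : q.Prime) (hr : r.Prime)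
    (hq2 : 3 < q) (hqr : q < r) :
    normalSubgroupOrderSum (QuaternionGroup q × Multiplicative (ZMod r)) =
      7 * (q * r) + 7 * q + 3 * r + 3 := by
  have hq0 : NeZero q := ⟨hq.ne_zero⟩
  have hr0 : NeZero r := ⟨hr.ne_zero⟩
  have c2q : Nat.Coprime 2 q := (Nat.coprime_primes Nat.prime_two hq).mpr (by omega)
  have c2r : Nat.Coprime 2 r := (Nat.coprime_primes Nat.prime_two hr).mpr (by omega)
  have hcr : Nat.card (Multiplicative (ZMod r)) = r := by simp
  have hcq : Nat.card (QuaternionGroup q) = 4 * q := by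
    rw [Nat.card_eq_fintype_card, QuaternionGroup.card]
  have hxa : ∀ i, orderOf ((QuaternionGroup.xa i, 1) :
      QuaternionGroup q × Multiplicative (ZMod r)) = 4 := fun i => by
    rw [Prod.orderOf_mk, QuaternionGroup.orderOf_xa, orderOf_one]
    rfl
  refine normalSubgroupOrderSum_eq_of_hasNormalOfCard hq hr hq2 hqr card_quaternionGroup_prod
    ⟨Subgroup.prod ⊥ ⊤, inferInstance, ?_⟩ ?_ ?_ ⟨Subgroup.prod ⊤ ⊥, inferInstance, ?_⟩
    ⟨(QuaternionGroup.xa 0, 1), hxa 0⟩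
  · rw [Nat.card_congr (Subgroup.prodEquiv _ _).toEquiv, Nat.card_prod, Subgroup.card_bot,
      Subgroup.card_top, hcr, one_mul]
  · have hz : (QuaternionGroup.a (q : ZMod (2 * q)) : QuaternionGroup q) =
        QuaternionGroup.xa 0 ^ 2 := by rw [QuaternionGroup.xa_sq]
    have hneg : -(q : ZMod (2 * q)) = q := by
      rw [neg_eq_iff_add_eq_zero, ← two_mul]
      exact_mod_cast ZMod.natCast_self (2 * q)
    have hcen : ((QuaternionGroup.a (q : ZMod (2 * q)), 1) :
        QuaternionGroup q × Multiplicative (ZMod r)) ∈ Subgroup.center _ := by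
      rw [Subgroup.mem_center_iff]
      rintro ⟨i | i, c⟩
      · simp [add_comm]
      · simp [sub_eq_add_neg, hneg]
    refine ⟨Subgroup.zpowers (QuaternionGroup.a (q : ZMod (2 * q)), 1), ?_, ?_⟩
    · constructor
      intro n hn g
      have h1 := (Subgroup.zpowers_le.mpr hcen) hn
      rwa [(Subgroup.mem_center_iff.mp h1 g), mul_inv_cancel_right]
    · rw [Nat.card_zpowers, Prod.orderOf_mk, orderOf_one, hz, orderOf_pow,
        QuaternionGroup.orderOf_xa]
      rfl
  -- A normal subgroup of order 4 has index coprime to 4, so it contains all 2q > 4 elements `xa i`,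
  -- which have order 4.
  · rintro ⟨N, hN, hNc⟩
    have hi : N.index = q * r := by
      have h1 := N.card_mul_index
      rw [hNc, card_quaternionGroup_prod] at h1
      exact Nat.eq_of_mul_eq_mul_left (by norm_num) h1
    have hmem : ∀ i, ((QuaternionGroup.xa i, 1) :
        QuaternionGroup q × Multiplicative (ZMod r)) ∈ N := fun i => by
      have h1 : Subgroup.zpowers ((QuaternionGroup.xa i, 1) :
          QuaternionGroup q × Multiplicative (ZMod r)) ≤ N :=
        Subgroup.le_of_coprime_card_index (by
          rw [Nat.card_zpowers, hxa, hi]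
          exact (c2q.mul_right c2r).pow_left 2)
      exact h1 (Subgroup.mem_zpowers _)
    let f : ZMod (2 * q) → N := fun i => ⟨_, hmem i⟩
    have hf : Function.Injective f := fun i j hij => by
      have := congrArg (fun y : N => y.1.1) hij
      exact QuaternionGroup.xa.inj this
    have h1 := Nat.card_le_card_of_injective f hf
    rw [hNc, Nat.card_zmod] at h1
    omega
  · rw [Nat.card_congr (Subgroup.prodEquiv _ _).toEquiv, Nat.card_prod, Subgroup.card_bot,
      Subgroup.card_top, hcq, mul_one]
    norm_num

/-- The numerical hypothesis is 7qr + 7q + 3r + 3 = 8qr after cancellation. -/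
theorem isLeinster_of_mulEquiv {G : Type*} [Group G] {q r : ℕ} (hq : q.Prime) (hr : r.Prime)
    (hq2 : 3 < q) (hqr : q < r) (h : q * r = 7 * q + 3 * r + 3)
    (e : G ≃* QuaternionGroup q × Multiplicative (ZMod r)) : IsLeinster G := by
  have hq0 : NeZero q := ⟨hq.ne_zero⟩
  have hr0 : NeZero r := ⟨hr.ne_zero⟩
  have hfin : Finite (QuaternionGroup q × Multiplicative (ZMod r)) :=
    Nat.finite_of_card_ne_zero (by
      rw [card_quaternionGroup_prod]
      exact mul_ne_zero (by norm_num) (mul_ne_zero hq.ne_zero hr.ne_zero))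
  refine ⟨Finite.of_equiv _ e.symm.toEquiv, ?_⟩
  rw [normalSubgroupOrderSum_congr e, Nat.card_congr e.toEquiv, card_quaternionGroup_prod,
    normalSubgroupOrderSum_quaternionGroup_prod hq hr hq2 hqr]
  omega

end Converse

/-- `QuaternionGroup n` is the generalized quaternion (dicyclic) group of order `4 * n`, so that
`QuaternionGroup 5` is `Q_20` and `QuaternionGroup 7` is `Q_28`; `Multiplicative (ZMod m)` is the
cyclic group `C_m`. -/
theorem theorem2p6 (p q r : ℕ) (hp : p.Prime) (hq : q.Prime) (hr : r.Prime)
    (hpq : p < q) (hqr : q < r) (G : Type*) [Group G] (hG : Nat.card G = p ^ 2 * q * r) :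
    IsLeinster G ↔
      Nonempty (G ≃* QuaternionGroup 5 × Multiplicative (ZMod 19)) ∨
        Nonempty (G ≃* QuaternionGroup 7 × Multiplicative (ZMod 13)) := by
  constructor
  · rintro ⟨-, hsum⟩
    rw [mul_assoc] at hG
    obtain ⟨rfl, hqr', hR, hZ, h4, hH, hx⟩ := classification_of_sum_eq hp hq hr hpq hqr hG hsum
    have h3 : 3 < q := by omega
    have h := nonempty_mulEquiv_quaternionGroup_prod hq hr h3 hqr hG hR hZ h4 hH hx
    rcases hqr' with ⟨rfl, rfl⟩ | ⟨rfl, rfl⟩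
    · exact Or.inl h
    · exact Or.inr h
  · rintro (⟨⟨e⟩⟩ | ⟨⟨e⟩⟩)
    · exact isLeinster_of_mulEquiv (by norm_num) (by norm_num) (by norm_num) (by norm_num)
        (by norm_num) e
    · exact isLeinster_of_mulEquiv (by norm_num) (by norm_num) (by norm_num) (by norm_num)
        (by norm_num) e
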